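/- Let $d\in\mathbb{N}$. There is a constant $C_d$, depending only on $d$, such that the following holds for all real numbers $a_1,\dots,a_d$ and all positive integers $\alpha_1,\dots,\alpha_d$. Put $Q(t)=a_1t^{\alpha_1}+\dots+a_dt^{\alpha_d}$ and, for $\varepsilon>0$, $$\mathcal{H}_{Q,\varepsilon}f(x,y)=\int_{|t|>\varepsilon}f(x-t,\,y-Q(t))\,\frac{dt}{t}.$$ For every $f\in L^2(\mathbb{R}^2)$ (complex-valued) and every $\varepsilon>0$ this integral converges absolutely for almost every $(x,y)$ and $\mathcal{H}_{Q,\varepsilon}f\in L^2(\mathbb{R}^2)$; the limit $$\mathcal{H}_Qf=\mathrm{p.v.}\int_{\mathbb{R}}f(x-t,\,y-Q(t))\,\frac{dt}{t}:=\lim_{\varepsilon\to0^+}\mathcal{H}_{Q,\varepsilon}f$$ exists in $L^2(\mathbb{R}^2)$. If $f$ is a Schwartz function, then the integrals $\mathcal{H}_{Q,\varepsilon}f(x,y)$ converge absolutely and the limit as $\varepsilon\to0^+$ exists at every point $(x,y)$, and this pointwise limit equals $\mathcal{H}_Qf$ almost everywhere. The operator $\mathcal{H}_Q$, the Hilbert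 transform along the curve $(t,Q(t))$, is a bounded linear operator on $L^2(\mathbb{R}^2)$, and $$\|\mathcal{H}_Qf\|_{L^2(\mathbb{R}^2)}\le C_d\,\|f\|_{L^2(\mathbb{R}^2)}\qquad\text{for all } f\in L^2(\mathbb{R}^2).$$ -/

import Mathlib

open MeasureTheory Filter Topology
open scoped SchwartzMap

noncomputable section

/-- The space `L²(ℝ²)` of complex-valued functions, with respect to Lebesgue measure. -/
abbrev L2Plane : Type := Lp ℂ 2 (volume : Measure (ℝ × ℝ))

/-- The real fewnomial `Q(t) = ∑ i, a i * t ^ (α i)` with `d` monomials. -/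
def fewnomial {d : ℕ} (a : Fin d → ℝ) (α : Fin d → ℕ) (t : ℝ) : ℝ :=
  ∑ i, a i * t ^ α i

/-- The integrand `t ↦ f (x - t, y - Q t) / t` of the Hilbert transform along the curve
`(t, Q t)` at the point `z = (x, y)`. -/
def curveIntegrand (Q : ℝ → ℝ) (f : ℝ × ℝ → ℂ) (z : ℝ × ℝ) (t : ℝ) : ℂ :=
  f (z.1 - t, z.2 - Q t) / (t : ℂ)

/-- The truncated Hilbert transform `∫_{|t| > ε} f (x - t, y - Q t) dt / t`. -/
def truncatedHilbert (Q : ℝ → ℝ) (ε : ℝ) (f : ℝ × ℝ → ℂ) (z : ℝ × ℝ) : ℂ :=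
  ∫ t in {t : ℝ | ε < |t|}, curveIntegrand Q f z t

/-- Pointwise principal value: `p.v. ∫ f (x - t, y - Q t) dt / t` exists at `z = (x, y)` and
equals `l`, every truncated integral being absolutely convergent. -/
def HasHilbertAt (Q : ℝ → ℝ) (f : ℝ × ℝ → ℂ) (z : ℝ × ℝ) (l : ℂ) : Prop :=
  (∀ ε : ℝ, 0 < ε → IntegrableOn (curveIntegrand Q f z) {t : ℝ | ε < |t|}) ∧
    Tendsto (fun ε : ℝ => truncatedHilbert Q ε f z) (𝓝[>] 0) (𝓝 l)

/-- Principal value in `L²(ℝ²)`: the truncated integrals converge absolutely almost everywhere,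
define functions in `L²`, and converge to `g` in `L²` norm as `ε → 0+`. -/
def HasHilbertL2 (Q : ℝ → ℝ) (f g : ℝ × ℝ → ℂ) : Prop :=
  (∀ ε : ℝ, 0 < ε →
    (∀ᵐ z : ℝ × ℝ, IntegrableOn (curveIntegrand Q f z) {t : ℝ | ε < |t|}) ∧
      MemLp (truncatedHilbert Q ε f) 2) ∧
    Tendsto (fun ε : ℝ => eLpNorm (truncatedHilbert Q ε f - g) 2) (𝓝[>] 0) (𝓝 0)

/-- `T` is the Hilbert transform along the curve `(t, Q t)` on `L²(ℝ²)`: it is the `L²` principal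
value for every function in `L²`, and agrees with the pointwise principal value, which exists
at every point, for every Schwartz function. -/
structure IsHilbertTransformAlong (Q : ℝ → ℝ) (T : L2Plane →L[ℂ] L2Plane) : Prop where
  hasHilbertL2 : ∀ f : L2Plane, HasHilbertL2 Q f (T f)
  schwartz : ∀ f : 𝓢(ℝ × ℝ, ℂ), ∃ g : ℝ × ℝ → ℂ,
    (∀ z, HasHilbertAt Q f z (g z)) ∧ T (f.toLp 2) =ᵐ[volume] g

end

/-! # Uniform `L²` bounds for Hilbert transforms along fewnomial curves

Truncated to an annulus `δ < |t| ≤ R`, the Hilbert transform along `(t, Q t)` is a Fourier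
multiplier with symbol `m(ξ) = ∫_{δ < |t| ≤ R} exp (-2πi (t ξ₁ + Q(t) ξ₂)) dt / t`. Its phase is a
polynomial `P` with zero constant term and at most `d + 1` monomials, so by Plancherel everything
reduces to bounding `∫_{δ < |t| ≤ R} exp (i P(t)) dt / t` in terms of the number `n` of monomials
of `P` only.

To bound it, let `s` be the scale at which the absolute values of the monomials of `P` add up to
`1`; it is the same for `P(t)` and `P(-t)`. For `t ≤ s` one has `|exp (i P(t)) - 1| ≤ t / s`, and
the constant `1` cancels between `t` and `-t`. For `t ≥ s` no cancellation between `t` and `-t` is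
needed. Put `θ(t) = t P'(t)`. A polynomial with `n` monomials has at most `2n` nonzero real roots
(`card_nonzero_roots_le`, by Rolle), so `(s, ∞)` splits into boundedly many intervals on each of
which `θ` is monotone and either `|θ| ≥ 1` or `|θ| ≤ 1`. On intervals of the first kind the integral
is at most `4` by van der Corput's integration by parts (`norm_integral_oscKernel_le_four`). An
interval `[u, v]` of the second kind has `v / u ≤ n 8 ^ n` (`div_le_of_abs_eval_le_one`): the
differences `q(2t) - 2 ^ k q(t)` remove the monomials of `θ` one at a time while preserving the
size of any chosen one of them, and some monomial of `θ` is large beyond the scale `s`.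

The passage to the operator goes as follows. By Fubini and Plancherel
(`integral_setHilbert_mul_conj`), the operator with `t` in an annulus is bounded on `L²` by the norm
of multiplication by `m`. Letting `R → ∞` with Fatou's lemma gives uniform bounds for the truncated
transforms. Since moreover `m(ξ) = O_ξ(R)` as `R → 0`, dominated convergence on the Fourier side
(`tendsto_eLpNorm_multiplier`) shows that the truncated transforms of an `L²` function form a Cauchy
family as `ε → 0`. For Schwartz functions the pointwise limit exists because
`f (z - (t, Q t)) - f (z - (-t, Q (-t))) = O(t)`. -/

/-! ### Nonzero roots, sublevel sets and van der Corput's lemma for fewnomials -/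

open Polynomial in
/-- A real polynomial with `n` monomials has at most `2 n` distinct nonzero roots. Dividing by a
power of `X` makes the constant term nonzero; differentiating then removes one monomial and, by
Rolle, loses at most one root, besides the root `0` that the derivative may have. -/
theorem card_nonzero_roots_le (p : ℝ[X]) :
    (p.roots.toFinset.erase 0).card ≤ 2 * p.support.card := by
  induction hn : p.natDegree using Nat.strong_induction_on generalizing p with
  | _ n ih =>
  by_cases hdeg : p.natDegree = 0
  · rw [natDegree_eq_zero] at hdeg
    obtain ⟨x, rfl⟩ := hdeg
    simp
  have hp0 : p ≠ 0 := by rintro rfl; simp at hdeg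
  by_cases h0 : p.coeff 0 = 0
  · have hX : X * p.divX = p := by
      have := X_mul_divX_add p
      simpa [h0] using this
    have hq0 : p.divX ≠ 0 := by intro h; rw [h] at hX; simp at hX; exact hp0 hX.symm
    have hc : p.support.card = p.divX.support.card := by
      conv_lhs => rw [← hX]
      have : (X * p.divX).support = p.divX.support.image (· + 1) := by
        ext k
        cases k <;> simp [coeff_X_mul]
      rw [this, Finset.card_image_of_injective _ (add_left_injective 1)]
    have hr : p.roots.toFinset.erase 0 = p.divX.roots.toFinset.erase 0 := by
      conv_lhs => rw [← hX]
      ext x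
      simp +contextual [hq0]
    rw [hr, hc]
    exact ih _ (by rw [natDegree_divX_eq_natDegree_tsub_one]; omega) _ rfl
  · have h1 := card_roots_toFinset_le_derivative p
    have h2 := ih _ (by rw [← hn]; exact natDegree_derivative_lt hdeg) (derivative p) rfl
    have h3 : (derivative p).support.card + 1 ≤ p.support.card := by
      have hsub : (derivative p).support.image (· + 1) ⊆ p.support.erase 0 := by
        intro k hk
        simp only [Finset.mem_image, mem_support_iff, coeff_derivative] at hk
        obtain ⟨a, ha, rfl⟩ := hk
        simp only [Finset.mem_erase, mem_support_iff]
        exact ⟨by omega, left_ne_zero_of_mul ha⟩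
      have := Finset.card_le_card hsub
      rw [Finset.card_image_of_injective _ (add_left_injective 1),
        Finset.card_erase_of_mem (mem_support_iff.2 h0)] at this
      have : 0 < p.support.card := Finset.card_pos.2 ⟨0, mem_support_iff.2 h0⟩
      omega
    have h4 := Finset.card_erase_le (s := p.roots.toFinset) (a := 0)
    have h5 := Finset.pred_card_le_card_erase (s := (derivative p).roots.toFinset) (a := 0)
    omega

/-- If `|∑ c k * t ^ k| ≤ M` on `[u, v]`, then each single monomial is bounded by `4 ^ m * M` at
points of `[u, v / 2 ^ m]`, where `m` is the number of the other monomials. The constant depends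
neither on the exponents nor on the coefficients. -/
theorem abs_mul_pow_le_of_abs_sum_le (j : ℕ) (S : Finset ℕ) :
    ∀ (c : ℕ → ℝ) (M u v : ℝ), j ∉ S → 0 < u →
      (∀ t ∈ Set.Icc u v, |c j * t ^ j + ∑ k ∈ S, c k * t ^ k| ≤ M) →
      ∀ t, u ≤ t → 2 ^ S.card * t ≤ v → |c j| * t ^ j ≤ 4 ^ S.card * M := by
  induction S using Finset.induction_on with
  | empty =>
    intro c M u v _ hu h t hut htv
    have := h t ⟨hut, by simpa using htv⟩
    simpa [abs_mul, abs_of_pos (hu.trans_le hut)] using this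
  | insert k S hk ih =>
    intro c M u v hj hu h t hut htv
    have hjk : j ≠ k := by rintro rfl; simp at hj
    have hjS : j ∉ S := fun h => hj (Finset.mem_insert_of_mem h)
    -- `q(2t) - 2 ^ k * q(t)` has no monomial of degree `k`. Dividing it by `N` keeps the `j`-th
    -- coefficient at least half as large, while the bound `M` at most doubles.
    set N : ℝ := 2 ^ (max j k) with hN
    have hNpos : 0 < N := by positivity
    rw [Finset.card_insert_of_notMem hk] at htv ⊢
    have hpt : (0:ℝ) < t := hu.trans_le hut
    have key := ih (fun l => c l * ((2:ℝ) ^ l - 2 ^ k) / N) (2 * M) u (v / 2) hjS hu ?_ t hut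
      (by rw [pow_succ] at htv; linarith)
    · have hfac : (1:ℝ) / 2 ≤ |((2:ℝ) ^ j - 2 ^ k) / N| := by
        rw [abs_div, abs_of_pos hNpos, div_le_div_iff₀ two_pos hNpos, one_mul]
        rcases lt_or_gt_of_ne hjk with hlt | hlt
        · have h1 : (2:ℝ) ^ (j+1) ≤ 2 ^ k := pow_le_pow_right₀ one_le_two hlt
          rw [hN, max_eq_right hlt.le, abs_sub_comm]
          rw [pow_succ] at h1
          have := le_abs_self ((2:ℝ)^k - 2^j)
          linarith
        · have h1 : (2:ℝ) ^ (k+1) ≤ 2 ^ j := pow_le_pow_right₀ one_le_two hlt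
          rw [hN, max_eq_left hlt.le]
          rw [pow_succ] at h1
          have := le_abs_self ((2:ℝ)^j - 2^k)
          linarith
      have h2 : |c j * ((2:ℝ) ^ j - 2 ^ k) / N| = |c j| * |((2:ℝ) ^ j - 2 ^ k) / N| := by
        rw [mul_div_assoc, abs_mul]
      simp only [h2] at key
      have h3 : |c j| * t ^ j * (1/2) ≤ |c j| * t ^ j * |((2:ℝ) ^ j - 2 ^ k) / N| :=
        mul_le_mul_of_nonneg_left hfac (by positivity)
      rw [pow_succ]
      nlinarith
    · intro s hs
      have hs0 : 0 < s := hu.trans_le hs.1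
      have e1 := h s ⟨hs.1, by linarith [hs.2]⟩
      have e2 := h (2 * s) ⟨by linarith [hs.1], by linarith [hs.2]⟩
      rw [Finset.sum_insert hk] at e1 e2
      have hid : c j * ((2:ℝ) ^ j - 2 ^ k) / N * s ^ j +
          ∑ l ∈ S, c l * ((2:ℝ) ^ l - 2 ^ k) / N * s ^ l =
          ((c j * (2 * s) ^ j + (c k * (2 * s) ^ k + ∑ l ∈ S, c l * (2 * s) ^ l)) -
            2 ^ k * (c j * s ^ j + (c k * s ^ k + ∑ l ∈ S, c l * s ^ l))) / N := by
        have : ∑ l ∈ S, c l * ((2:ℝ) ^ l - 2 ^ k) / N * s ^ l =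
            (∑ l ∈ S, c l * (2 * s) ^ l - 2 ^ k * ∑ l ∈ S, c l * s ^ l) / N := by
          rw [Finset.mul_sum, ← Finset.sum_sub_distrib, Finset.sum_div]
          refine Finset.sum_congr rfl fun l _ => ?_
          rw [mul_pow]; ring
        rw [this, mul_pow, mul_pow]
        ring
      rw [hid, abs_div, abs_of_pos hNpos, div_le_iff₀ hNpos]
      have hM : 0 ≤ M := (abs_nonneg _).trans e1
      have h2k : (2:ℝ) ^ k ≤ N := pow_le_pow_right₀ one_le_two (le_max_right _ _)
      have h1N : (1:ℝ) ≤ N := one_le_pow₀ one_le_two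
      refine (abs_sub _ _).trans ?_
      rw [abs_mul, abs_of_pos (show (0:ℝ) < 2 ^ k by positivity)]
      have : (2:ℝ)^k * |c j * s ^ j + (c k * s ^ k + ∑ l ∈ S, c l * s ^ l)| ≤ N * M :=
        mul_le_mul h2k e1 (abs_nonneg _) hNpos.le
      nlinarith

/-- If the integral of `f` is bounded by `K` over every subinterval whose interior misses the
finite set `Z`, then over the whole interval it is bounded by `2 ^ |Z| * K`. -/
theorem norm_integral_le_two_pow_mul {f : ℝ → ℂ} {K : ℝ} (hf : ContinuousOn f (Set.Ioi 0))
    (Z : Finset ℝ) : ∀ a b : ℝ, 0 < a → a ≤ b →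
      (∀ u v, a ≤ u → u ≤ v → v ≤ b → (∀ z ∈ Z, z ∉ Set.Ioo u v) → ‖∫ t in u..v, f t‖ ≤ K) →
      ‖∫ t in a..b, f t‖ ≤ 2 ^ Z.card * K := by
  have hint : ∀ a b : ℝ, 0 < a → 0 < b → IntervalIntegrable f volume a b := fun a b ha hb =>
    (hf.mono fun x hx => lt_of_lt_of_le (lt_min ha hb) hx.1).intervalIntegrable
  induction Z using Finset.induction_on with
  | empty =>
    intro a b _ hab h
    simpa using h a b le_rfl hab le_rfl (by simp)
  | insert z Z hz ih =>
    intro a b ha hab h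
    rw [Finset.card_insert_of_notMem hz]
    have hK : 0 ≤ K := by simpa using h a a le_rfl le_rfl hab (by simp)
    have hK2 : 0 ≤ 2 ^ Z.card * K := by positivity
    by_cases hzab : z ∈ Set.Ioo a b
    · have hz0 : 0 < z := ha.trans hzab.1
      have h1 := ih a z ha hzab.1.le fun u v hu huv hv hZ => h u v hu huv (hv.trans hzab.2.le) (by
        intro w hw
        rcases Finset.mem_insert.1 hw with rfl | hw
        · exact fun hh => absurd hh.2 (not_lt.2 hv)
        · exact hZ w hw)
      have h2 := ih z b hz0 hzab.2.le fun u v hu huv hv hZ => h u v (hzab.1.le.trans hu) huv hv (by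
        intro w hw
        rcases Finset.mem_insert.1 hw with rfl | hw
        · exact fun hh => absurd hh.1 (not_lt.2 hu)
        · exact hZ w hw)
      rw [← intervalIntegral.integral_add_adjacent_intervals (hint a z ha hz0)
        (hint z b hz0 (hz0.trans hzab.2)), pow_succ]
      refine (norm_add_le _ _).trans ?_
      linarith
    · have h1 := ih a b ha hab fun u v hu huv hv hZ => h u v hu huv hv (by
        intro w hw
        rcases Finset.mem_insert.1 hw with rfl | hw
        · exact fun hh => hzab ⟨hu.trans_lt hh.1, hh.2.trans_le hv⟩
        · exact hZ w hw)
      rw [pow_succ]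
      linarith

open Polynomial in
theorem eval_nonneg_or_nonpos_of_no_root {p : ℝ[X]} {u v : ℝ}
    (h : ∀ t ∈ Set.Ioo u v, p.eval t ≠ 0) :
    (∀ t ∈ Set.Icc u v, 0 ≤ p.eval t) ∨ (∀ t ∈ Set.Icc u v, p.eval t ≤ 0) := by
  by_contra! hc
  obtain ⟨⟨s, hs, hs0⟩, t, ht, ht0⟩ := hc
  obtain ⟨r, hr, hr0⟩ := intermediate_value_uIcc (p.continuous.continuousOn (s := Set.uIcc s t))
    (show (0:ℝ) ∈ Set.uIcc (p.eval s) (p.eval t) from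
      ⟨(min_le_left _ _).trans hs0.le, ht0.le.trans (le_max_right _ _)⟩)
  have hrs : r ≠ s := by rintro rfl; exact hs0.ne hr0
  have hrt : r ≠ t := by rintro rfl; exact ht0.ne' hr0
  rw [Set.mem_uIcc] at hr
  refine h r ?_ hr0
  rcases hr with hr | hr
  · exact ⟨hs.1.trans_lt (lt_of_le_of_ne hr.1 hrs.symm), (lt_of_le_of_ne hr.2 hrt).trans_le ht.2⟩
  · exact ⟨ht.1.trans_lt (lt_of_le_of_ne hr.1 hrt.symm), (lt_of_le_of_ne hr.2 hrs).trans_le hs.2⟩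

/-- The oscillating kernel `exp (i P(t)) / t`. -/
noncomputable def oscKernel (P : Polynomial ℝ) (t : ℝ) : ℂ :=
  Complex.exp (Complex.I * (P.eval t : ℝ)) / (t : ℂ)

theorem norm_oscKernel (P : Polynomial ℝ) (t : ℝ) : ‖oscKernel P t‖ = |t|⁻¹ := by
  rw [oscKernel, norm_div, mul_comm, Complex.norm_exp_ofReal_mul_I, Complex.norm_real,
    Real.norm_eq_abs, one_div]

theorem continuousOn_oscKernel (P : Polynomial ℝ) : ContinuousOn (oscKernel P) {0}ᶜ := by
  unfold oscKernel
  refine ContinuousOn.div (Continuous.continuousOn ?_) Complex.continuous_ofReal.continuousOn ?_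
  · have := P.continuous
    fun_prop
  · intro x hx
    exact_mod_cast hx

open Polynomial in
/-- Van der Corput's first derivative test for the measure `dt / t`: here `t P'(t)` plays the role
of the derivative of the phase. -/
theorem norm_integral_oscKernel_le_four {P : ℝ[X]} {u v : ℝ} (huv : u ≤ v)
    (h1 : ∀ t ∈ Set.Icc u v, 1 ≤ |(X * derivative P).eval t|)
    (h2 : (∀ t ∈ Set.Icc u v, 0 ≤ (derivative (X * derivative P)).eval t) ∨
      (∀ t ∈ Set.Icc u v, (derivative (X * derivative P)).eval t ≤ 0)) :
    ‖∫ t in u..v, oscKernel P t‖ ≤ 4 := by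
  set q := X * derivative P with hq
  have hne : ∀ t ∈ Set.uIcc u v, q.eval t ≠ 0 := by
    intro t ht h0
    rw [Set.uIcc_of_le huv] at ht
    have := h1 t ht
    rw [h0] at this
    norm_num at this
  have hqc := q.continuous
  have hq'c := (derivative q).continuous
  -- Integrate `exp (i P) P'` against the amplitude `1 / q`, which is monotone, so that the integral
  -- of the absolute value of its derivative is the difference of its boundary values.
  have hg : ∀ t ∈ Set.uIcc u v, HasDerivAt (fun t => (q.eval t)⁻¹)
      (-(derivative q).eval t / (q.eval t) ^ 2) t := fun t ht =>
    (q.hasDerivAt t).inv (hne t ht)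
  have hgc : ContinuousOn (fun t => -(derivative q).eval t / (q.eval t) ^ 2) (Set.uIcc u v) :=
    hq'c.neg.continuousOn.div (hqc.pow 2).continuousOn fun t ht => pow_ne_zero 2 (hne t ht)
  have hgC : ∀ t ∈ Set.uIcc u v, HasDerivAt (fun t => (((q.eval t)⁻¹ : ℝ) : ℂ))
      ((-(derivative q).eval t / (q.eval t) ^ 2 : ℝ) : ℂ) t := fun t ht =>
    (hg t ht).ofReal_comp
  have hw : ∀ t ∈ Set.uIcc u v, HasDerivAt
      (fun t => -Complex.I * Complex.exp (Complex.I * (P.eval t : ℝ)))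
      (((derivative P).eval t : ℝ) * Complex.exp (Complex.I * (P.eval t : ℝ))) t := by
    intro t _
    have := (((P.hasDerivAt t).ofReal_comp.const_mul Complex.I).cexp).const_mul (-Complex.I)
    refine this.congr_deriv ?_
    linear_combination (-(((derivative P).eval t : ℝ):ℂ) *
      Complex.exp (Complex.I * (P.eval t : ℝ))) * Complex.I_mul_I
  have hibp := intervalIntegral.integral_mul_deriv_eq_deriv_mul hgC hw
    (Complex.continuous_ofReal.comp_continuousOn hgc).intervalIntegrable
    (Continuous.intervalIntegrable (by
      have := P.continuous
      have := (derivative P).continuous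
      fun_prop) _ _)
  have heq : ∫ t in u..v, oscKernel P t = ∫ t in u..v, (((q.eval t)⁻¹ : ℝ) : ℂ) *
      (((derivative P).eval t : ℝ) * Complex.exp (Complex.I * (P.eval t : ℝ))) := by
    refine intervalIntegral.integral_congr fun t ht => ?_
    have h3 := hne t ht
    simp only [hq, eval_mul, eval_X] at h3 ⊢
    have h4 := left_ne_zero_of_mul h3
    have h5 := right_ne_zero_of_mul h3
    have h4' : (t:ℂ) ≠ 0 := by exact_mod_cast h4
    have h5' : (((derivative P).eval t : ℝ) : ℂ) ≠ 0 := by exact_mod_cast h5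
    rw [oscKernel]
    push_cast
    field_simp
  have hnw : ∀ t, ‖-Complex.I * Complex.exp (Complex.I * (P.eval t : ℝ))‖ = 1 := by
    intro t
    rw [norm_mul, norm_neg, Complex.norm_I, one_mul, mul_comm, Complex.norm_exp_ofReal_mul_I]
  have hgb : ∀ t ∈ Set.Icc u v, |(q.eval t)⁻¹| ≤ 1 := fun t ht => by
    rw [abs_inv]; exact inv_le_one_of_one_le₀ (h1 t ht)
  have hgb' : ∀ t ∈ Set.Icc u v, ‖(((q.eval t)⁻¹ : ℝ) : ℂ)‖ ≤ 1 := fun t ht => by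
    rw [Complex.norm_real]; exact hgb t ht
  have hul : u ∈ Set.Icc u v := ⟨le_rfl, huv⟩
  have hvl : v ∈ Set.Icc u v := ⟨huv, le_rfl⟩
  have hftc := intervalIntegral.integral_eq_sub_of_hasDerivAt hg hgc.intervalIntegrable
  have hrem : ‖∫ t in u..v, ((-(derivative q).eval t / (q.eval t) ^ 2 : ℝ) : ℂ) *
      (-Complex.I * Complex.exp (Complex.I * (P.eval t : ℝ)))‖ ≤ 2 := by
    refine (intervalIntegral.norm_integral_le_integral_norm huv).trans ?_
    have : ∀ t, ‖((-(derivative q).eval t / (q.eval t) ^ 2 : ℝ) : ℂ) *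
      (-Complex.I * Complex.exp (Complex.I * (P.eval t : ℝ)))‖ =
        |(derivative q).eval t| / (q.eval t) ^ 2 := fun t => by
      rw [norm_mul, hnw, mul_one, Complex.norm_real, Real.norm_eq_abs, abs_div, abs_neg, abs_pow,
        sq_abs]
    simp_rw [this]
    have hb := hgb u hul
    have hb' := hgb v hvl
    rw [abs_le] at hb hb'
    rcases h2 with h2 | h2
    · have : ∫ t in u..v, |(derivative q).eval t| / (q.eval t) ^ 2 =
          - ∫ t in u..v, -(derivative q).eval t / (q.eval t) ^ 2 := by
        rw [← intervalIntegral.integral_neg]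
        refine intervalIntegral.integral_congr fun t ht => ?_
        rw [Set.uIcc_of_le huv] at ht
        simp only [abs_of_nonneg (h2 t ht)]
        ring
      rw [this, hftc]
      linarith
    · have : ∫ t in u..v, |(derivative q).eval t| / (q.eval t) ^ 2 =
          ∫ t in u..v, -(derivative q).eval t / (q.eval t) ^ 2 := by
        refine intervalIntegral.integral_congr fun t ht => ?_
        rw [Set.uIcc_of_le huv] at ht
        simp only [abs_of_nonpos (h2 t ht)]
      rw [this, hftc]
      linarith
  rw [heq, hibp]
  refine (norm_sub_le _ _).trans ?_
  have := norm_sub_le ((((q.eval v)⁻¹ : ℝ) : ℂ) *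
    (-Complex.I * Complex.exp (Complex.I * (P.eval v : ℝ)))) ((((q.eval u)⁻¹ : ℝ) : ℂ) *
    (-Complex.I * Complex.exp (Complex.I * (P.eval u : ℝ))))
  rw [norm_mul, norm_mul _ (-Complex.I * Complex.exp (Complex.I * (P.eval u : ℝ))), hnw, hnw]
    at this
  linarith [hgb' u hul, hgb' v hvl]

/-! ### Oscillatory integrals with fewnomial phase -/

open Polynomial in
theorem eval_X_mul_derivative (P : ℝ[X]) (t : ℝ) :
    (X * derivative P).eval t = ∑ k ∈ P.support, (k * P.coeff k) * t ^ k := by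
  rw [eval_mul, eval_X, derivative_eval, Polynomial.sum, Finset.mul_sum]
  refine Finset.sum_congr rfl fun k _ => ?_
  cases k with
  | zero => simp
  | succ k => rw [Nat.add_sub_cancel, pow_succ]; ring

open Polynomial in
/-- The size of a polynomial at scale `s`: the sum of the absolute values of its monomials. -/
noncomputable def absSum (P : ℝ[X]) (s : ℝ) : ℝ := ∑ k ∈ P.support, |P.coeff k| * s ^ k

open Polynomial in
/-- Beyond the scale `s` at which the monomials of `P` add up to `1`, the function `t P'(t)` is
bounded by `1` only on intervals of bounded logarithmic length. -/
theorem div_le_of_abs_eval_le_one {P : ℝ[X]} {n : ℕ} {s u v : ℝ} (h0 : P.coeff 0 = 0)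
    (hn : P.support.card ≤ n) (hs : 0 < s) (hsum : absSum P s = 1) (hsu : s ≤ u)
    (h : ∀ t ∈ Set.Icc u v, |(X * derivative P).eval t| ≤ 1) : v / u ≤ n * 8 ^ n := by
  have hu : 0 < u := hs.trans_le hsu
  have hne : P.support.Nonempty := by
    by_contra hc
    rw [Finset.not_nonempty_iff_eq_empty] at hc
    rw [absSum, hc] at hsum
    simp at hsum
  have hn0 : (0:ℝ) < n := by exact_mod_cast (Finset.card_pos.2 hne).trans_le hn
  have hn1 : (1:ℝ) ≤ n := by exact_mod_cast (Finset.card_pos.2 hne).trans_le hn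
  obtain ⟨j, hj, hjs⟩ : ∃ j ∈ P.support, 1 / (n:ℝ) ≤ |P.coeff j| * s ^ j := by
    by_contra! hc
    have h1 := Finset.sum_lt_sum_of_nonempty hne hc
    rw [Finset.sum_const, nsmul_eq_mul] at h1
    have h2 : (P.support.card : ℝ) * (1 / n) ≤ 1 := by
      rw [mul_one_div, div_le_one hn0]; exact_mod_cast hn
    unfold absSum at hsum
    linarith
  have hj1 : 1 ≤ j := by
    rw [Nat.one_le_iff_ne_zero]; rintro rfl; exact (mem_support_iff.1 hj) h0
  -- The `j`-th monomial of `t P'(t)` at `s` is at least `1 / n`, and it grows at least linearly.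
  set m := (P.support.erase j).card with hm
  have hmn : m ≤ n := (Finset.card_erase_le).trans hn
  have hm8 : (8:ℝ) ^ m ≤ 8 ^ n := pow_le_pow_right₀ (by norm_num) hmn
  by_cases hvu : v < 2 ^ m * u
  · rw [div_le_iff₀ hu]
    have h1 : (2:ℝ) ^ m ≤ 8 ^ m := pow_le_pow_left₀ (by norm_num) (by norm_num) _
    have h2 : (8:ℝ) ^ n ≤ n * 8 ^ n := le_mul_of_one_le_left (by positivity) hn1
    exact hvu.le.trans (mul_le_mul_of_nonneg_right (h1.trans (hm8.trans h2)) hu.le)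
  · rw [not_lt] at hvu
    obtain ⟨t, htv, hut⟩ : ∃ t, 2 ^ m * t = v ∧ u ≤ t :=
      ⟨v / 2 ^ m, by field_simp, by rw [le_div_iff₀ (by positivity)]; linarith⟩
    have key := abs_mul_pow_le_of_abs_sum_le j (P.support.erase j) (fun k => k * P.coeff k) 1 u v
      (by simp) hu (fun x hx => by
        have := h x hx
        rw [eval_X_mul_derivative, ← Finset.add_sum_erase _ _ hj] at this
        exact this) t hut htv.le
    have h1 : |(j:ℝ) * P.coeff j| * t ^ j ≥ |P.coeff j| * t ^ j := by
      rw [abs_mul, abs_of_nonneg (Nat.cast_nonneg j)]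
      have : (1:ℝ) ≤ j := by exact_mod_cast hj1
      have hh : 0 ≤ |P.coeff j| * t ^ j := by
        have : 0 < t := hu.trans_le hut
        positivity
      nlinarith
    have hts : 1 ≤ t / s := by rw [one_le_div hs]; linarith
    have h2 : |P.coeff j| * t ^ j = |P.coeff j| * s ^ j * (t / s) ^ j := by
      rw [div_pow]; field_simp
    have h3 : t / s ≤ (t / s) ^ j := le_self_pow₀ hts (by omega)
    have h4 : 1 / (n:ℝ) * (t / s) ≤ |P.coeff j| * s ^ j * (t / s) ^ j :=
      mul_le_mul hjs h3 (by positivity) (by positivity)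
    have h5 : t / s ≤ n * 4 ^ m := by
      have : 1 / (n:ℝ) * (t / s) ≤ 4 ^ m := by linarith
      rw [one_div, inv_mul_le_iff₀ hn0] at this
      exact this
    have h6 : v / u ≤ 2 ^ m * (t / s) := by
      rw [← htv, mul_div_assoc]
      exact mul_le_mul_of_nonneg_left
        (div_le_div_of_nonneg_left (hu.le.trans hut) hs hsu) (by positivity)
    calc v / u ≤ 2 ^ m * (t / s) := h6
      _ ≤ 2 ^ m * (n * 4 ^ m) := by gcongr
      _ = n * 8 ^ m := by
        rw [show (8:ℝ) = 2 * 4 by norm_num, mul_pow]; ring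
      _ ≤ n * 8 ^ n := by gcongr

theorem norm_integral_oscKernel_le_div (P : Polynomial ℝ) {u v : ℝ} (hu : 0 < u) (huv : u ≤ v) :
    ‖∫ t in u..v, oscKernel P t‖ ≤ v / u := by
  have := intervalIntegral.norm_integral_le_of_norm_le_const (a := u) (b := v)
    (f := oscKernel P) (C := u⁻¹) fun t ht => by
      rw [Set.uIoc_of_le huv] at ht
      rw [norm_oscKernel, abs_of_pos (hu.trans ht.1)]
      exact inv_anti₀ hu ht.1.le
  refine this.trans ?_
  rw [abs_of_nonneg (by linarith), div_eq_inv_mul]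
  have := inv_pos.2 hu
  nlinarith

open Polynomial in
/-- Beyond the scale `s` at which the monomials of `P` add up to `1`, the one-sided oscillatory
integral is bounded in terms of the number of monomials. -/
theorem norm_integral_oscKernel_le {P : ℝ[X]} {n : ℕ} {s u v : ℝ} (h0 : P.coeff 0 = 0)
    (hn : P.support.card ≤ n) (hs : 0 < s) (hsum : absSum P s = 1) (hsu : s ≤ u) (huv : u ≤ v) :
    ‖∫ t in u..v, oscKernel P t‖ ≤ 2 ^ (6 * n + 4) * (4 + n * 8 ^ n) := by
  classical
  set q := X * derivative P with hq
  -- Away from `Z`, the polynomial `q` is monotone and stays on one side of `1` and of `-1`.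
  set Z : Finset ℝ := (derivative q).roots.toFinset.erase 0 ∪
    ((q - C 1).roots.toFinset.erase 0 ∪ (q + C 1).roots.toFinset.erase 0) with hZ
  have hP0 : P ≠ 0 := by
    rintro rfl
    simp [absSum] at hsum
  have hcoeff : ∀ k, q.coeff k = k * P.coeff k := by
    intro k
    cases k with
    | zero => simp [hq]
    | succ k => rw [hq, coeff_X_mul, coeff_derivative]; push_cast; ring
  have hqs : q.support.card ≤ n := by
    refine le_trans (Finset.card_le_card fun k hk => ?_) hn
    rw [mem_support_iff, hcoeff] at hk
    exact mem_support_iff.2 (right_ne_zero_of_mul hk)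
  have hC : ((C 1 : ℝ[X]).support.card) ≤ 1 := by
    have := card_support_C_mul_X_pow_le_one (c := (1:ℝ)) (n := 0)
    simpa using this
  have hq's : (derivative q).support.card ≤ n := by
    refine le_trans ?_ hqs
    have hsub : (derivative q).support.image (· + 1) ⊆ q.support := by
      intro k hk
      simp only [Finset.mem_image, mem_support_iff, coeff_derivative] at hk
      obtain ⟨a, ha, rfl⟩ := hk
      exact mem_support_iff.2 (left_ne_zero_of_mul ha)
    have := Finset.card_le_card hsub
    rwa [Finset.card_image_of_injective _ (add_left_injective 1)] at this
  have hqp : (q + C 1).support.card ≤ n + 1 := by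
    have e1 := Finset.card_le_card (support_add (p := q) (q := C 1))
    have e2 := Finset.card_union_le q.support (C 1 : ℝ[X]).support
    omega
  have hqm : (q - C 1).support.card ≤ n + 1 := by
    have e1 := Finset.card_le_card (support_add (p := q) (q := -C 1))
    have e2 := Finset.card_union_le q.support (-C 1 : ℝ[X]).support
    rw [support_neg] at e2
    rw [support_neg, ← sub_eq_add_neg] at e1
    omega
  have hZc : Z.card ≤ 6 * n + 4 := by
    have e1 := card_nonzero_roots_le (derivative q)
    have e2 := card_nonzero_roots_le (q - C 1)
    have e3 := card_nonzero_roots_le (q + C 1)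
    have e4 := Finset.card_union_le ((q - C 1).roots.toFinset.erase 0)
      ((q + C 1).roots.toFinset.erase 0)
    have e5 : Z.card ≤ _ := Finset.card_union_le ((derivative q).roots.toFinset.erase 0)
      ((q - C 1).roots.toFinset.erase 0 ∪ (q + C 1).roots.toFinset.erase 0)
    omega
  have hq0 : q.coeff 0 = 0 := by simp [hcoeff]
  have hqne : q ≠ 0 := by
    obtain ⟨k, hk⟩ := nonempty_support_iff.2 hP0
    intro hc
    have := hcoeff k
    rw [hc, coeff_zero] at this
    rcases mul_eq_zero.1 this.symm with h | h
    · rw [Nat.cast_eq_zero] at h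
      subst h
      exact mem_support_iff.1 hk h0
    · exact mem_support_iff.1 hk h
  have hq'ne : derivative q ≠ 0 := by
    intro hc
    have h1 := derivative_eq_zero.1 hc
    rw [natDegree_eq_zero] at h1
    obtain ⟨x, hx⟩ := h1
    rw [← hx, coeff_C_zero] at hq0
    rw [hq0, C_0] at hx
    exact hqne hx.symm
  have hqmne : q - C 1 ≠ 0 := by
    intro hc
    have := congrArg (fun p => coeff p 0) hc
    simp [hq0] at this
  have hqpne : q + C 1 ≠ 0 := by
    intro hc
    have := congrArg (fun p => coeff p 0) hc
    simp [hq0] at this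
  have hu : 0 < u := hs.trans_le hsu
  have hKn : (0:ℝ) ≤ n * 8 ^ n := by positivity
  have main := norm_integral_le_two_pow_mul (f := oscKernel P) (K := 4 + n * 8 ^ n)
    ((continuousOn_oscKernel P).mono fun x hx => ne_of_gt hx) Z u v hu huv ?_
  · refine main.trans ?_
    gcongr
    norm_num
  intro a b hua hab hbv hz
  have ha : 0 < a := hu.trans_le hua
  have hroot : ∀ p : ℝ[X], p ≠ 0 → p.roots.toFinset.erase 0 ⊆ Z →
      (∀ t ∈ Set.Icc a b, 0 ≤ p.eval t) ∨ (∀ t ∈ Set.Icc a b, p.eval t ≤ 0) := by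
    intro p hp hpZ
    refine eval_nonneg_or_nonpos_of_no_root fun t ht h => hz t (hpZ ?_) ht
    rw [Finset.mem_erase, Multiset.mem_toFinset, mem_roots hp]
    exact ⟨(ha.trans ht.1).ne', h⟩
  have h1 := hroot _ hq'ne Finset.subset_union_left
  have h2 := hroot _ hqmne (Finset.subset_union_left.trans Finset.subset_union_right)
  have h3 := hroot _ hqpne (Finset.subset_union_right.trans Finset.subset_union_right)
  simp only [eval_sub, eval_add, eval_C] at h2 h3
  rcases h2 with h2 | h2
  · refine (norm_integral_oscKernel_le_four hab (fun t ht => ?_) h1).trans (by linarith)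
    exact (by linarith [h2 t ht] : 1 ≤ q.eval t).trans (le_abs_self _)
  rcases h3 with h3 | h3
  · refine (norm_integral_oscKernel_le_div P ha hab).trans ?_
    have := div_le_of_abs_eval_le_one h0 hn hs hsum (hsu.trans hua) fun t ht => by
      rw [abs_le]; constructor <;> linarith [h2 t ht, h3 t ht]
    linarith
  · refine (norm_integral_oscKernel_le_four hab (fun t ht => ?_) h1).trans (by linarith)
    exact (by linarith [h3 t ht] : 1 ≤ -q.eval t).trans (neg_le_abs _)

open Polynomial in
theorem exists_absSum_eq_one {P : ℝ[X]} (h0 : P.coeff 0 = 0) (hP : P ≠ 0) :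
    ∃ s, 0 < s ∧ absSum P s = 1 := by
  obtain ⟨j, hj⟩ := nonempty_support_iff.2 hP
  have hj0 : j ≠ 0 := by rintro rfl; exact mem_support_iff.1 hj h0
  have hb : 0 < |P.coeff j| := abs_pos.2 (mem_support_iff.1 hj)
  set T := |P.coeff j|⁻¹ + 1 with hT
  have hT1 : 1 ≤ T := by rw [hT]; linarith [inv_pos.2 hb]
  have hcont : Continuous (absSum P) := by unfold absSum; fun_prop
  have hz : absSum P 0 = 0 := by
    refine Finset.sum_eq_zero fun k hk => ?_
    have : k ≠ 0 := by rintro rfl; exact mem_support_iff.1 hk h0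
    simp [this]
  have hlarge : 1 ≤ absSum P T := by
    have h1 : |P.coeff j| * T ^ j ≤ absSum P T :=
      Finset.single_le_sum (f := fun k => |P.coeff k| * T ^ k) (fun k _ => by positivity) hj
    have h2 : T ≤ T ^ j := le_self_pow₀ hT1 hj0
    have h3 : |P.coeff j| * T = 1 + |P.coeff j| := by rw [hT]; field_simp
    nlinarith
  obtain ⟨s, hs, hs1⟩ := intermediate_value_Icc (a := (0:ℝ)) (b := T) (by linarith)
    hcont.continuousOn (show (1:ℝ) ∈ Set.Icc (absSum P 0) (absSum P T) from
      ⟨by rw [hz]; norm_num, hlarge⟩)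
  refine ⟨s, lt_of_le_of_ne hs.1 ?_, hs1⟩
  rintro rfl
  rw [hz] at hs1
  norm_num at hs1

open Polynomial in
theorem abs_eval_le_absSum_mul (P : ℝ[X]) (h0 : P.coeff 0 = 0) {s t : ℝ} (ht : 0 ≤ t) (hs : 0 < s)
    (hts : t ≤ s) : |P.eval t| ≤ absSum P s * (t / s) := by
  rw [eval_eq_sum, Polynomial.sum, absSum, Finset.sum_mul]
  refine (Finset.abs_sum_le_sum_abs _ _).trans (Finset.sum_le_sum fun k hk => ?_)
  have hk0 : k ≠ 0 := by rintro rfl; exact mem_support_iff.1 hk h0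
  rw [abs_mul, abs_pow, abs_of_nonneg ht, mul_assoc]
  refine mul_le_mul_of_nonneg_left ?_ (abs_nonneg _)
  have h1 : (t / s) ^ k ≤ t / s := pow_le_of_le_one (by positivity) ((div_le_one hs).2 hts) hk0
  calc t ^ k = s ^ k * (t / s) ^ k := by rw [div_pow]; field_simp
    _ ≤ s ^ k * (t / s) := by gcongr

theorem norm_oscKernel_sub_inv_le (P : Polynomial ℝ) (h0 : P.coeff 0 = 0) {s t : ℝ} (ht : 0 < t)
    (hts : t ≤ s) : ‖oscKernel P t - (t : ℂ)⁻¹‖ ≤ absSum P s / s := by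
  have hs : 0 < s := ht.trans_le hts
  have h1 : oscKernel P t - (t : ℂ)⁻¹ =
      (Complex.exp (Complex.I * (P.eval t : ℝ)) - 1) / (t:ℂ) := by
    rw [oscKernel]; ring
  rw [h1, norm_div, Complex.norm_real, Real.norm_eq_abs, abs_of_pos ht, div_le_iff₀ ht]
  refine (Real.norm_exp_I_mul_ofReal_sub_one_le (x := P.eval t)).trans ?_
  rw [Real.norm_eq_abs]
  refine (abs_eval_le_absSum_mul P h0 ht.le hs hts).trans (le_of_eq ?_)
  ring

/-- The difference of the kernels of `P(t)` and `P(-t)`. -/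
noncomputable def oscDiff (P : Polynomial ℝ) (t : ℝ) : ℂ :=
  oscKernel P t - oscKernel (P.comp (-Polynomial.X)) t

open Polynomial in
theorem coeff_comp_neg_X (P : ℝ[X]) (k : ℕ) : (P.comp (-X)).coeff k = (-1) ^ k * P.coeff k := by
  have : (-X : ℝ[X]) = C (-1) * X := by simp
  rw [this, comp_C_mul_X_coeff, mul_comm]

open Polynomial in
theorem support_comp_neg_X (P : ℝ[X]) : (P.comp (-X)).support = P.support := by
  ext k
  simp [mem_support_iff, coeff_comp_neg_X]

open Polynomial in
theorem absSum_comp_neg_X (P : ℝ[X]) (s : ℝ) : absSum (P.comp (-X)) s = absSum P s := by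
  simp [absSum, support_comp_neg_X, coeff_comp_neg_X, abs_mul]

/-- Below the scale `s` the kernels of `P(t)` and `P(-t)` are both close to `1 / t`, which
cancels. -/
theorem norm_oscDiff_le (P : Polynomial ℝ) (h0 : P.coeff 0 = 0) {s t : ℝ} (ht : 0 < t)
    (hts : t ≤ s) : ‖oscDiff P t‖ ≤ 2 * (absSum P s / s) := by
  have h1 := norm_oscKernel_sub_inv_le P h0 ht hts
  have h2 := norm_oscKernel_sub_inv_le (P.comp (-Polynomial.X))
    (by rw [coeff_comp_neg_X, h0, mul_zero]) ht hts
  rw [absSum_comp_neg_X] at h2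
  have h3 := norm_sub_le (oscKernel P t - (t : ℂ)⁻¹)
    (oscKernel (P.comp (-Polynomial.X)) t - (t : ℂ)⁻¹)
  rw [sub_sub_sub_cancel_right] at h3
  exact h3.trans (by linarith)

theorem intervalIntegrable_oscKernel (P : Polynomial ℝ) {a b : ℝ} (ha : 0 < a) (hb : 0 < b) :
    IntervalIntegrable (oscKernel P) volume a b :=
  ((continuousOn_oscKernel P).mono fun _ hx =>
    (lt_of_lt_of_le (lt_min ha hb) hx.1).ne').intervalIntegrable

theorem intervalIntegrable_oscDiff (P : Polynomial ℝ) {a b : ℝ} (ha : 0 < a) (hb : 0 < b) :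
    IntervalIntegrable (oscDiff P) volume a b :=
  (intervalIntegrable_oscKernel P ha hb).sub (intervalIntegrable_oscKernel _ ha hb)

theorem norm_integral_oscDiff_le_small (P : Polynomial ℝ) (h0 : P.coeff 0 = 0) {s u v : ℝ}
    (hu : 0 < u) (huv : u ≤ v) (hvs : v ≤ s) :
    ‖∫ t in u..v, oscDiff P t‖ ≤ 2 * (absSum P s / s) * v := by
  have h := intervalIntegral.norm_integral_le_of_norm_le_const (a := u) (b := v)
    (f := oscDiff P) (C := 2 * (absSum P s / s)) fun t ht => by
      rw [Set.uIoc_of_le huv] at ht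
      exact norm_oscDiff_le P h0 (hu.trans ht.1) (ht.2.trans hvs)
  refine h.trans ?_
  rw [abs_of_nonneg (by linarith)]
  have : 0 ≤ 2 * (absSum P s / s) := (norm_nonneg _).trans (norm_oscDiff_le P h0 hu (huv.trans hvs))
  nlinarith

/-- The uniform bound for the symmetric oscillatory integral. -/
theorem norm_integral_oscDiff_le {P : Polynomial ℝ} {n : ℕ} {u v : ℝ} (h0 : P.coeff 0 = 0)
    (hn : P.support.card ≤ n) (hu : 0 < u) (huv : u ≤ v) :
    ‖∫ t in u..v, oscDiff P t‖ ≤ 2 + 2 * (2 ^ (6 * n + 4) * (4 + n * 8 ^ n)) := by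
  set K : ℝ := 2 ^ (6 * n + 4) * (4 + n * 8 ^ n) with hK
  have hK0 : 0 ≤ K := by positivity
  by_cases hP : P = 0
  · subst hP
    simp only [oscDiff, Polynomial.zero_comp, sub_self, intervalIntegral.integral_zero, norm_zero]
    linarith
  obtain ⟨s, hs, hsum⟩ := exists_absSum_eq_one h0 hP
  have hsmall : ∀ a b, 0 < a → a ≤ b → b ≤ s → ‖∫ t in a..b, oscDiff P t‖ ≤ 2 := by
    intro a b ha hab hbs
    refine (norm_integral_oscDiff_le_small P h0 ha hab hbs).trans ?_
    rw [hsum, mul_assoc, one_div, inv_mul_eq_div]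
    have := (div_le_one hs).2 hbs
    linarith
  have hlarge : ∀ a b, s ≤ a → a ≤ b → ‖∫ t in a..b, oscDiff P t‖ ≤ 2 * K := by
    intro a b hsa hab
    have ha : 0 < a := hs.trans_le hsa
    have hb : 0 < b := ha.trans_le hab
    have h1 := norm_integral_oscKernel_le h0 hn hs hsum hsa hab
    have h2 := norm_integral_oscKernel_le (P := P.comp (-Polynomial.X)) (n := n)
      (by rw [coeff_comp_neg_X, h0, mul_zero])
      (by rwa [support_comp_neg_X]) hs (by rwa [absSum_comp_neg_X]) hsa hab
    simp only [oscDiff]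
    rw [intervalIntegral.integral_sub (intervalIntegrable_oscKernel _ ha hb)
      (intervalIntegrable_oscKernel _ ha hb)]
    exact (norm_sub_le _ _).trans (by linarith)
  rcases le_total v s with hvs | hsv
  · exact (hsmall u v hu huv hvs).trans (by linarith)
  rcases le_total s u with hsu | hus
  · exact (hlarge u v hsu huv).trans (by linarith)
  rw [← intervalIntegral.integral_add_adjacent_intervals (b := s)
    (intervalIntegrable_oscDiff P hu hs) (intervalIntegrable_oscDiff P hs (hs.trans_le hsv))]
  exact (norm_add_le _ _).trans (add_le_add (hsmall u s hu hus le_rfl) (hlarge s v le_rfl hsv))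

/-! ### The Fourier multiplier of an annulus -/

/-- The symmetric annulus `δ < |t| ≤ R` in `ℝ`. -/
def annulus (δ R : ℝ) : Set ℝ := {t | δ < |t| ∧ |t| ≤ R}

theorem measurableSet_annulus (δ R : ℝ) : MeasurableSet (annulus δ R) :=
  (measurableSet_lt measurable_const measurable_id.abs).inter
    (measurableSet_le measurable_id.abs measurable_const)

theorem setIntegral_annulus {g : ℝ → ℂ} {δ R : ℝ} (hδ : 0 < δ) (hR : δ ≤ R)
    (hg : ContinuousOn g {0}ᶜ) :
    ∫ t in annulus δ R, g t = ∫ t in δ..R, (g t + g (-t)) := by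
  have hset : annulus δ R = Set.Ioc δ R ∪ Set.Ico (-R) (-δ) := by
    ext t
    simp only [annulus, Set.mem_ofPred_eq, Set.mem_union, Set.mem_Ioc, Set.mem_Ico, lt_abs, abs_le]
    constructor
    · rintro ⟨h | h, h1, h2⟩
      · exact Or.inl ⟨h, h2⟩
      · exact Or.inr ⟨h1, by linarith⟩
    · rintro (⟨h1, h2⟩ | ⟨h1, h2⟩)
      · exact ⟨Or.inl h1, by linarith, h2⟩
      · exact ⟨Or.inr (by linarith), h1, by linarith⟩
  have hdisj : Disjoint (Set.Ioc δ R) (Set.Ico (-R) (-δ)) := by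
    rw [Set.disjoint_left]
    rintro t ⟨h1, _⟩ ⟨_, h2⟩
    linarith
  have hi1 : IntervalIntegrable g volume δ R :=
    (hg.mono fun x hx => (lt_of_lt_of_le (lt_min hδ (hδ.trans_le hR)) hx.1).ne').intervalIntegrable
  have hi2 : IntervalIntegrable g volume (-R) (-δ) :=
    (hg.mono fun x hx => (lt_of_le_of_lt hx.2
      (max_lt (by linarith) (by linarith))).ne).intervalIntegrable
  have hi3 : IntervalIntegrable (fun t => g (-t)) volume δ R := by
    have := hi2.comp_sub_left 0
    simpa using this.symm
  rw [hset, setIntegral_union hdisj measurableSet_Ico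
    ((intervalIntegrable_iff_integrableOn_Ioc_of_le hR).1 hi1)
    ((intervalIntegrable_iff_integrableOn_Ico_of_le (by linarith)).1 hi2),
    intervalIntegral.integral_add hi1 hi3, intervalIntegral.integral_comp_neg,
    intervalIntegral.integral_of_le hR, intervalIntegral.integral_of_le (by linarith : -R ≤ -δ),
    integral_Ico_eq_integral_Ioc]

/-- The Fourier multiplier of the Hilbert transform along `(t, Q t)` restricted to `t ∈ s`. -/
noncomputable def curveMultiplier (Q : ℝ → ℝ) (s : Set ℝ) (ξ : ℝ × ℝ) : ℂ :=
  ∫ t in s, (Real.fourierChar (-(t * ξ.1 + Q t * ξ.2)) : ℂ) / (t : ℂ)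

open Polynomial in
/-- The phase `-2π (t ξ₁ + Q(t) ξ₂)` as a polynomial in `t`. -/
noncomputable def phasePoly {d : ℕ} (a : Fin d → ℝ) (α : Fin d → ℕ) (ξ : ℝ × ℝ) : ℝ[X] :=
  C (-(2 * Real.pi * ξ.1)) * X ^ 1 + ∑ i, C (-(2 * Real.pi * ξ.2 * a i)) * X ^ α i

open Polynomial in
theorem eval_phasePoly {d : ℕ} (a : Fin d → ℝ) (α : Fin d → ℕ) (ξ : ℝ × ℝ) (t : ℝ) :
    (phasePoly a α ξ).eval t = 2 * Real.pi * (-(t * ξ.1 + fewnomial a α t * ξ.2)) := by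
  have : ∑ i, -(2 * Real.pi * ξ.2 * a i) * t ^ α i =
      -(2 * Real.pi * ξ.2) * ∑ i, a i * t ^ α i := by
    rw [Finset.mul_sum]
    exact Finset.sum_congr rfl fun i _ => by ring
  simp only [phasePoly, eval_add, eval_mul, eval_C, eval_pow, eval_X, eval_finsetSum, fewnomial]
  rw [this]
  ring

open Polynomial in
theorem coeff_zero_phasePoly {d : ℕ} (a : Fin d → ℝ) (α : Fin d → ℕ) (hα : ∀ i, 0 < α i)
    (ξ : ℝ × ℝ) : (phasePoly a α ξ).coeff 0 = 0 := by
  rw [coeff_zero_eq_eval_zero, eval_phasePoly]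
  simp [fewnomial, fun i => (hα i).ne']

open Polynomial in
theorem card_support_phasePoly_le {d : ℕ} (a : Fin d → ℝ) (α : Fin d → ℕ) (ξ : ℝ × ℝ) :
    (phasePoly a α ξ).support.card ≤ d + 1 := by
  classical
  have hsub : (phasePoly a α ξ).support ⊆ insert 1 (Finset.univ.image α) := by
    intro k hk
    by_contra hc
    simp only [Finset.mem_insert, Finset.mem_image, Finset.mem_univ, true_and, not_or,
      not_exists] at hc
    refine mem_support_iff.1 hk ?_
    simp only [phasePoly, coeff_add, coeff_C_mul, coeff_X_pow, finsetSum_coeff, if_neg hc.1,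
      mul_zero, zero_add]
    exact Finset.sum_eq_zero fun i _ => by rw [if_neg (fun h => hc.2 i h.symm), mul_zero]
  refine (Finset.card_le_card hsub).trans ((Finset.card_insert_le _ _).trans ?_)
  have := Finset.card_image_le (s := Finset.univ) (f := α)
  rw [Finset.card_univ, Fintype.card_fin] at this
  omega

theorem curveMultiplier_annulus_eq {d : ℕ} (a : Fin d → ℝ) (α : Fin d → ℕ) (ξ : ℝ × ℝ) {δ R : ℝ}
    (hδ : 0 < δ) (hR : δ ≤ R) :
    curveMultiplier (fewnomial a α) (annulus δ R) ξ = ∫ t in δ..R, oscDiff (phasePoly a α ξ) t := by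
  have h1 : ∀ t : ℝ, (Real.fourierChar (-(t * ξ.1 + fewnomial a α t * ξ.2)) : ℂ) / (t : ℂ) =
      oscKernel (phasePoly a α ξ) t := by
    intro t
    rw [Real.fourierChar_apply, oscKernel, eval_phasePoly, mul_comm Complex.I]
  rw [curveMultiplier]
  simp_rw [h1]
  rw [setIntegral_annulus hδ hR (continuousOn_oscKernel _)]
  refine intervalIntegral.integral_congr fun t _ => ?_
  simp only [oscDiff, oscKernel, Polynomial.eval_comp, Polynomial.eval_neg, Polynomial.eval_X]
  push_cast
  ring

/-- The multipliers are bounded by a constant depending only on the number of monomials of `Q`. -/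
theorem exists_norm_curveMultiplier_le (d : ℕ) :
    ∃ C : ℝ, ∀ (a : Fin d → ℝ) (α : Fin d → ℕ), (∀ i, 0 < α i) →
      ∀ (ξ : ℝ × ℝ) (δ R : ℝ), 0 < δ → δ ≤ R →
        ‖curveMultiplier (fewnomial a α) (annulus δ R) ξ‖ ≤ C := by
  refine ⟨2 + 2 * (2 ^ (6 * (d + 1) + 4) * (4 + (d + 1 : ℕ) * 8 ^ (d + 1))), ?_⟩
  intro a α hα ξ δ R hδ hR
  rw [curveMultiplier_annulus_eq a α ξ hδ hR]
  exact norm_integral_oscDiff_le (coeff_zero_phasePoly a α hα ξ)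
    (card_support_phasePoly_le a α ξ) hδ hR

/-- For fixed frequency the multipliers of small annuli tend to `0`. -/
theorem exists_norm_curveMultiplier_le_mul {d : ℕ} (a : Fin d → ℝ) (α : Fin d → ℕ)
    (hα : ∀ i, 0 < α i) (ξ : ℝ × ℝ) :
    ∃ M : ℝ, ∀ δ R : ℝ, 0 < δ → δ ≤ R → R ≤ 1 →
      ‖curveMultiplier (fewnomial a α) (annulus δ R) ξ‖ ≤ M * R := by
  refine ⟨2 * (absSum (phasePoly a α ξ) 1 / 1), fun δ R hδ hR hR1 => ?_⟩
  rw [curveMultiplier_annulus_eq a α ξ hδ hR]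
  exact norm_integral_oscDiff_le_small _ (coeff_zero_phasePoly a α hα ξ) hδ hR hR1

theorem continuous_fewnomial {d : ℕ} (a : Fin d → ℝ) (α : Fin d → ℕ) :
    Continuous (fewnomial a α) := by
  unfold fewnomial
  fun_prop

/-! ### Translations and the Fourier transform on `L²` -/

section Fourier
open FourierTransform

variable {E : Type*} [NormedAddCommGroup E] [InnerProductSpace ℝ E] [FiniteDimensional ℝ E]
  [MeasurableSpace E] [BorelSpace E]

theorem fourier_comp_sub (f : E → ℂ) (v ξ : E) :
    𝓕 (fun x => f (x - v)) ξ = (Real.fourierChar (-inner ℝ v ξ) : ℂ) * 𝓕 f ξ := by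
  have := congrFun (VectorFourier.fourierIntegral_comp_add_right Real.fourierChar
    (volume : Measure E) (innerₗ E) f (-v)) ξ
  simp only [Function.comp_def, ← sub_eq_add_neg, map_neg, LinearMap.neg_apply, innerₗ_apply_apply,
    Circle.smul_def, smul_eq_mul] at this
  exact this

theorem memLp_fourierChar_mul (v : E) (g : E → ℂ) (hg : MemLp g 2) :
    MemLp (fun ξ => (Real.fourierChar (inner ℝ v ξ) : ℂ) * g ξ) 2 := by
  refine hg.of_le (AEStronglyMeasurable.mul (Continuous.aestronglyMeasurable ?_) hg.1) ?_
  · fun_prop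
  · exact Eventually.of_forall fun ξ => by rw [norm_mul, Circle.norm_coe, one_mul]

/-- The Fourier transform on `L²` turns translation by `v` into multiplication by the character
`exp (-2πi ⟪v, ξ⟫)`, in weak form. Both sides are continuous in `f`, so it suffices to treat
Schwartz functions, for which the Fourier transform is given by the integral. -/
theorem inner_comp_sub_eq (f g : Lp ℂ 2 (volume : Measure E)) (v : E) :
    ∫ x, f (x - v) * (starRingEnd ℂ) (g x) =
      ∫ ξ, (Real.fourierChar (-inner ℝ v ξ) : ℂ) *
        ((𝓕 f : Lp ℂ 2 (volume : Measure E)) ξ *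
          (starRingEnd ℂ) ((𝓕 g : Lp ℂ 2 (volume : Measure E)) ξ)) := by
  set τ : Lp ℂ 2 (volume : Measure E) →ₗᵢ[ℂ] Lp ℂ 2 (volume : Measure E) :=
    Lp.compMeasurePreservingₗᵢ ℂ (fun x => x - v) (measurePreserving_sub_right volume v) with hτ
  have hτc : ∀ f, τ f =ᵐ[volume] fun x => f (x - v) := fun f =>
    Lp.coeFn_compMeasurePreserving f (measurePreserving_sub_right volume v)
  have hg' := memLp_fourierChar_mul v _ (Lp.memLp (𝓕 g : Lp ℂ 2 (volume : Measure E)))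
  have hL : ∀ f : Lp ℂ 2 (volume : Measure E), ∫ x, f (x - v) * (starRingEnd ℂ) (g x) =
      inner ℂ g (τ f) := fun f => by
    rw [L2.inner_def]
    refine integral_congr_ae ?_
    filter_upwards [hτc f] with x hx
    rw [hx, RCLike.inner_apply]
  have hR : ∀ f : Lp ℂ 2 (volume : Measure E), ∫ ξ, (Real.fourierChar (-inner ℝ v ξ) : ℂ) *
        ((𝓕 f : Lp ℂ 2 (volume : Measure E)) ξ *
          (starRingEnd ℂ) ((𝓕 g : Lp ℂ 2 (volume : Measure E)) ξ)) =
      inner ℂ (hg'.toLp _) (𝓕 f : Lp ℂ 2 (volume : Measure E)) := fun f => by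
    rw [L2.inner_def]
    refine integral_congr_ae ?_
    filter_upwards [hg'.coeFn_toLp] with x hx
    rw [hx, RCLike.inner_apply, map_mul, AddChar.map_neg_eq_inv, Circle.coe_inv_eq_conj]
    ring
  rw [hL, hR]
  have hcl : IsClosed {f : Lp ℂ 2 (volume : Measure E) | inner ℂ g (τ f) =
      inner ℂ (hg'.toLp _) (𝓕 f : Lp ℂ 2 (volume : Measure E))} :=
    isClosed_eq (continuous_const.inner τ.continuous)
      (continuous_const.inner (Lp.fourierTransformₗᵢ E ℂ).continuous)
  refine DenseRange.induction_on (p := fun f : Lp ℂ 2 (volume : Measure E) => inner ℂ g (τ f) =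
      inner ℂ (hg'.toLp _) (𝓕 f : Lp ℂ 2 (volume : Measure E)))
    (SchwartzMap.denseRange_toLpCLM (p := 2) ENNReal.ofNat_ne_top) f hcl fun φ => ?_
  rw [← hR]
  simp only [SchwartzMap.toLpCLM_apply]
  have h1 : τ (φ.toLp 2) = (φ.compSubConstCLM ℂ v).toLp 2 := by
    refine Lp.ext ?_
    have h0 : ∀ᵐ x : E, (φ.toLp 2 : Lp ℂ 2 (volume : Measure E)) x = φ x :=
      φ.coeFn_toLp 2 volume
    filter_upwards [hτc (φ.toLp 2), (φ.compSubConstCLM ℂ v).coeFn_toLp 2,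
      (measurePreserving_sub_right volume v).quasiMeasurePreserving.ae h0]
      with x h1 h2 h3
    rw [h1, h2, h3]
    rfl
  rw [h1, ← Lp.inner_fourier_eq, SchwartzMap.toLp_fourier_eq, SchwartzMap.toLp_fourier_eq,
    L2.inner_def]
  refine integral_congr_ae ?_
  filter_upwards [(𝓕 φ).coeFn_toLp 2, (𝓕 (φ.compSubConstCLM ℂ v)).coeFn_toLp 2] with x hx hx'
  rw [hx, hx', RCLike.inner_apply, SchwartzMap.fourier_coe, SchwartzMap.fourier_coe]
  have := fourier_comp_sub φ v x
  simp only [← mul_assoc]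
  rw [← this]
  rfl

end Fourier

/-- The plane with its Euclidean norm. -/
abbrev EPlane : Type := WithLp 2 (ℝ × ℝ)

/-- The Fourier transform of an `L²` function on `ℝ × ℝ`, as a function on the Euclidean plane. -/
noncomputable def planeFourier : L2Plane →ₗᵢ[ℂ] Lp ℂ 2 (volume : Measure EPlane) :=
  (Lp.fourierTransformₗᵢ EPlane ℂ).toLinearIsometry.comp
    (Lp.compMeasurePreservingₗᵢ ℂ _ (WithLp.volume_preserving_ofLp ℝ ℝ))

theorem integral_comp_sub_mul_conj (f g : L2Plane) (v : ℝ × ℝ) :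
    ∫ z, f (z - v) * (starRingEnd ℂ) (g z) =
      ∫ ξ : EPlane, (Real.fourierChar (-(v.1 * ξ.fst + v.2 * ξ.snd)) : ℂ) *
        (planeFourier f ξ * (starRingEnd ℂ) (planeFourier g ξ)) := by
  have hmp := WithLp.volume_preserving_ofLp ℝ ℝ
  have h := inner_comp_sub_eq (Lp.compMeasurePreservingₗᵢ ℂ _ hmp f)
    (Lp.compMeasurePreservingₗᵢ ℂ _ hmp g) (WithLp.toLp 2 v)
  have h1 : ∀ ξ : EPlane, inner ℝ (WithLp.toLp 2 v) ξ = v.1 * ξ.fst + v.2 * ξ.snd := by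
    intro ξ
    simp [WithLp.prod_inner_apply, mul_comm]
  simp only [h1] at h
  refine Eq.trans ?_ h
  have hme : MeasurableEmbedding (@WithLp.ofLp 2 (ℝ × ℝ)) :=
    (MeasurableEquiv.toLp 2 (ℝ × ℝ)).symm.measurableEmbedding
  rw [← hmp.integral_comp hme]
  refine integral_congr_ae ?_
  filter_upwards [Lp.coeFn_compMeasurePreserving g hmp,
    (measurePreserving_sub_right volume (WithLp.toLp 2 v)).quasiMeasurePreserving.ae
      (Lp.coeFn_compMeasurePreserving f hmp)] with x h2 h3
  simp only [Lp.compMeasurePreservingₗᵢ_apply_coe] at h2 h3 ⊢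
  erw [h2, h3]
  rfl

/-! ### Joint measurability and the shear along the curve -/

theorem sq_norm_integral_le {X : Type*} [MeasurableSpace X] {ν : Measure X} [IsFiniteMeasure ν]
    {u : X → ℂ} (hu : MemLp u 2 ν) : ‖∫ x, u x ∂ν‖ ^ 2 ≤ ν.real Set.univ * ∫ x, ‖u x‖ ^ 2 ∂ν := by
  have h1 : Integrable (fun x => ‖u x‖) ν := (hu.integrable one_le_two).norm
  have h2 : Integrable (fun x => ‖u x‖ ^ 2) ν := (memLp_two_iff_integrable_sq_norm hu.1).1 hu
  set M := ν.real Set.univ with hM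
  set I := ∫ x, ‖u x‖ ∂ν with hI
  set S := ∫ x, ‖u x‖ ^ 2 ∂ν with hS
  have hI0 : 0 ≤ I := integral_nonneg fun x => norm_nonneg _
  have hM0 : 0 ≤ M := measureReal_nonneg
  have hle : ‖∫ x, u x ∂ν‖ ≤ I := norm_integral_le_integral_norm _
  -- Integrate the square of `M * ‖u‖ - I`.
  have hexp : ∫ x, (M * ‖u x‖ - I) ^ 2 ∂ν = M * (M * S - I ^ 2) := by
    have : ∀ x, (M * ‖u x‖ - I) ^ 2 = M ^ 2 * ‖u x‖ ^ 2 - 2 * M * I * ‖u x‖ + I ^ 2 :=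
      fun x => by ring
    have h3 : Integrable (fun x => M ^ 2 * ‖u x‖ ^ 2 - 2 * M * I * ‖u x‖) ν :=
      (h2.const_mul _).sub (h1.const_mul _)
    simp_rw [this]
    rw [integral_add h3 (integrable_const _),
      integral_sub (h2.const_mul _) (h1.const_mul _), integral_const_mul, integral_const_mul,
      integral_const, smul_eq_mul]
    ring
  have hpos : 0 ≤ M * (M * S - I ^ 2) := hexp ▸ integral_nonneg fun x => sq_nonneg _
  have hfin : I ^ 2 ≤ M * S := by
    rcases hM0.eq_or_lt with h0 | h0
    · have : ν = 0 := by
        rw [← Measure.measure_univ_eq_zero]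
        exact (measureReal_eq_zero_iff (by simp)).1 h0.symm
      have : I = 0 := by rw [hI, this, integral_zero_measure]
      rw [this, ← h0]; simp
    · nlinarith [nonneg_of_mul_nonneg_right hpos h0]
  exact (pow_le_pow_left₀ (norm_nonneg _) hle 2).trans hfin

/-- The shear `(t, z) ↦ (t, z - (t, Q t))` preserves `ν × dz`. -/
theorem measurePreserving_shear {Q : ℝ → ℝ} (hQ : Continuous Q) (ν : Measure ℝ) [SFinite ν] :
    MeasurePreserving (fun p : ℝ × (ℝ × ℝ) => (p.1, p.2 - (p.1, Q p.1)))
      (ν.prod volume) (ν.prod volume) := by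
  refine (MeasurePreserving.id ν).skew_product (g := fun t z => z - (t, Q t)) ?_ ?_
  · have : Continuous (Function.uncurry fun (t : ℝ) (z : ℝ × ℝ) => z - (t, Q t)) := by
      unfold Function.uncurry
      fun_prop
    exact this.measurable
  · exact Eventually.of_forall fun t => (measurePreserving_sub_right volume (t, Q t)).map_eq

/-- A property that holds almost everywhere in the plane holds along almost every translate of the
curve, for almost every parameter. In particular the transforms do not depend on the
representative of `f`. -/
theorem ae_ae_shear {Q : ℝ → ℝ} (hQ : Continuous Q) {p : ℝ × ℝ → Prop} (hp : ∀ᵐ w, p w) :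
    ∀ᵐ z : ℝ × ℝ, ∀ᵐ t : ℝ, p (z.1 - t, z.2 - Q t) := by
  have h1 : ∀ᵐ q ∂((volume : Measure ℝ).prod (volume : Measure (ℝ × ℝ))),
      p (q.2 - (q.1, Q q.1)) :=
    (Measure.quasiMeasurePreserving_snd.comp
      (measurePreserving_shear hQ volume).quasiMeasurePreserving).ae hp
  have h2 := (Measure.measurePreserving_swap (μ := (volume : Measure (ℝ × ℝ)))
    (ν := (volume : Measure ℝ))).quasiMeasurePreserving.ae h1
  exact Measure.ae_ae_of_ae_prod h2

/-- The Hilbert transform along `(t, Q t)` with the parameter `t` restricted to `s`. -/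
noncomputable def setHilbert (Q : ℝ → ℝ) (s : Set ℝ) (f : ℝ × ℝ → ℂ) (z : ℝ × ℝ) : ℂ :=
  ∫ t in s, curveIntegrand Q f z t

theorem measurable_curveIntegrand {Q : ℝ → ℝ} (hQ : Continuous Q) {f : ℝ × ℝ → ℂ}
    (hf : Measurable f) : Measurable fun p : ℝ × (ℝ × ℝ) => curveIntegrand Q f p.2 p.1 := by
  unfold curveIntegrand
  have h1 : Measurable fun p : ℝ × (ℝ × ℝ) => (p.2.1 - p.1, p.2.2 - Q p.1) := by
    have : Continuous fun p : ℝ × (ℝ × ℝ) => (p.2.1 - p.1, p.2.2 - Q p.1) := by fun_prop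
    exact this.measurable
  exact (hf.comp h1).div (Complex.measurable_ofReal.comp measurable_fst)

theorem stronglyMeasurable_setHilbert {Q : ℝ → ℝ} (hQ : Continuous Q) {f : ℝ × ℝ → ℂ}
    (hf : Measurable f) (s : Set ℝ) : StronglyMeasurable (setHilbert Q s f) :=
  StronglyMeasurable.integral_prod_left' (μ := volume.restrict s)
    (measurable_curveIntegrand hQ hf).stronglyMeasurable

theorem measurable_coe_L2Plane (f : L2Plane) : Measurable f := (Lp.stronglyMeasurable f).measurable

/-! ### The transform on an annulus -/

theorem volume_annulus_lt_top (δ R : ℝ) : volume (annulus δ R) < ⊤ := by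
  refine (measure_mono (t := Set.Icc (-R) R) fun t ht => ?_).trans_lt measure_Icc_lt_top
  exact abs_le.1 ht.2

instance isFiniteMeasure_restrict_annulus (δ R : ℝ) :
    IsFiniteMeasure (volume.restrict (annulus δ R)) :=
  ⟨by rw [Measure.restrict_apply_univ]; exact volume_annulus_lt_top δ R⟩

theorem ae_prod_annulus_norm_inv_le {X : Type*} [MeasurableSpace X] (μ : Measure X) [SFinite μ]
    {δ R : ℝ} (hδ : 0 < δ) :
    ∀ᵐ p : ℝ × X ∂((volume.restrict (annulus δ R)).prod μ), ‖((p.1 : ℂ))⁻¹‖ ≤ δ⁻¹ := by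
  have h : ∀ᵐ t : ℝ ∂(volume.restrict (annulus δ R)), ‖((t : ℂ))⁻¹‖ ≤ δ⁻¹ := by
    filter_upwards [ae_restrict_mem (measurableSet_annulus δ R)] with t ht
    rw [norm_inv, Complex.norm_real, Real.norm_eq_abs]
    exact inv_anti₀ hδ ht.1.le
  exact Measure.quasiMeasurePreserving_fst.ae h

/-- The integrand is square integrable jointly in `t` and `z`, since it is bounded by `δ⁻¹ |f|`
composed with the measure preserving shear. -/
theorem memLp_curveIntegrand_annulus {Q : ℝ → ℝ} (hQ : Continuous Q) {δ R : ℝ} (hδ : 0 < δ)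
    (f : L2Plane) : MemLp (fun p : ℝ × (ℝ × ℝ) => curveIntegrand Q f p.2 p.1) 2
      ((volume.restrict (annulus δ R)).prod volume) := by
  have h1 : MemLp (fun p : ℝ × (ℝ × ℝ) => f (p.2 - (p.1, Q p.1))) 2
      ((volume.restrict (annulus δ R)).prod volume) :=
    ((Lp.memLp f).comp_snd _).comp_measurePreserving (measurePreserving_shear hQ _)
  refine (h1.const_mul ((δ⁻¹ : ℝ) : ℂ)).of_le
    (measurable_curveIntegrand hQ (measurable_coe_L2Plane f)).aestronglyMeasurable ?_
  filter_upwards [ae_prod_annulus_norm_inv_le volume hδ] with p hp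
  rw [curveIntegrand, div_eq_mul_inv, norm_mul, norm_mul, mul_comm, Complex.norm_real,
    Real.norm_eq_abs, abs_of_pos (inv_pos.2 hδ)]
  exact mul_le_mul_of_nonneg_right hp (norm_nonneg _)

theorem memLp_setHilbert_annulus {Q : ℝ → ℝ} (hQ : Continuous Q) {δ R : ℝ} (hδ : 0 < δ)
    (f : L2Plane) : MemLp (setHilbert Q (annulus δ R) f) 2 := by
  have hK := memLp_curveIntegrand_annulus hQ (R := R) hδ f
  have hKi := (memLp_two_iff_integrable_sq_norm hK.1).1 hK
  have hm := (stronglyMeasurable_setHilbert hQ (measurable_coe_L2Plane f)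
    (annulus δ R)).aestronglyMeasurable (μ := volume)
  rw [memLp_two_iff_integrable_sq_norm hm]
  refine (hKi.integral_prod_right.const_mul
    ((volume.restrict (annulus δ R)).real Set.univ)).mono' (hm.norm.pow 2) ?_
  filter_upwards [hKi.prod_left_ae] with z hz
  rw [Real.norm_of_nonneg (sq_nonneg _)]
  refine sq_norm_integral_le ((memLp_two_iff_integrable_sq_norm ?_).2 hz)
  exact ((measurable_curveIntegrand hQ (measurable_coe_L2Plane f)).comp
    measurable_prodMk_right).aestronglyMeasurable

theorem measurable_char_div {Q : ℝ → ℝ} (hQ : Continuous Q) :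
    Measurable fun p : ℝ × EPlane =>
      (Real.fourierChar (-(p.1 * p.2.fst + Q p.1 * p.2.snd)) : ℂ) / (p.1 : ℂ) := by
  refine Measurable.div (Continuous.measurable ?_) (Complex.measurable_ofReal.comp measurable_fst)
  fun_prop

theorem stronglyMeasurable_curveMultiplier {Q : ℝ → ℝ} (hQ : Continuous Q) (s : Set ℝ) :
    StronglyMeasurable fun ξ : EPlane => curveMultiplier Q s (ξ.fst, ξ.snd) :=
  StronglyMeasurable.integral_prod_left' (μ := volume.restrict s)
    (measurable_char_div hQ).stronglyMeasurable

/-- The transform over an annulus is the Fourier multiplier `curveMultiplier`, in weak form. -/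
theorem integral_setHilbert_mul_conj {Q : ℝ → ℝ} (hQ : Continuous Q) {δ R : ℝ} (hδ : 0 < δ)
    (f g : L2Plane) :
    ∫ z, setHilbert Q (annulus δ R) f z * (starRingEnd ℂ) (g z) =
      ∫ ξ : EPlane, curveMultiplier Q (annulus δ R) (ξ.fst, ξ.snd) *
        (planeFourier f ξ * (starRingEnd ℂ) (planeFourier g ξ)) := by
  set ν := volume.restrict (annulus δ R) with hν
  have hi1 : Integrable (fun p : ℝ × (ℝ × ℝ) =>
      curveIntegrand Q f p.2 p.1 * (starRingEnd ℂ) (g p.2)) (ν.prod volume) :=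
    (memLp_curveIntegrand_annulus hQ hδ f).integrable_mul ((Lp.memLp g).star.comp_snd ν)
  have hh : Integrable (fun ξ : EPlane => planeFourier f ξ *
      (starRingEnd ℂ) (planeFourier g ξ)) :=
    (Lp.memLp (planeFourier f)).integrable_mul (Lp.memLp (planeFourier g)).star
  have hi2 : Integrable (fun p : ℝ × EPlane =>
      (Real.fourierChar (-(p.1 * p.2.fst + Q p.1 * p.2.snd)) : ℂ) / (p.1 : ℂ) *
        (planeFourier f p.2 * (starRingEnd ℂ) (planeFourier g p.2))) (ν.prod volume) := by
    refine (hh.comp_snd ν).bdd_mul (c := δ⁻¹) (measurable_char_div hQ).aestronglyMeasurable ?_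
    filter_upwards [ae_prod_annulus_norm_inv_le volume hδ] with p hp
    rw [div_eq_mul_inv, norm_mul, Circle.norm_coe, one_mul]
    exact hp
  have hL : ∫ z, setHilbert Q (annulus δ R) f z * (starRingEnd ℂ) (g z) =
      ∫ t, (∫ z, curveIntegrand Q f z t * (starRingEnd ℂ) (g z)) ∂ν := by
    rw [integral_integral_swap (f := fun t z => curveIntegrand Q f z t * (starRingEnd ℂ) (g z)) hi1]
    refine integral_congr_ae (Eventually.of_forall fun z => ?_)
    exact (integral_mul_const _ _).symm
  have hR : ∫ ξ : EPlane, curveMultiplier Q (annulus δ R) (ξ.fst, ξ.snd) *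
        (planeFourier f ξ * (starRingEnd ℂ) (planeFourier g ξ)) =
      ∫ t, (∫ ξ : EPlane, (Real.fourierChar (-(t * ξ.fst + Q t * ξ.snd)) : ℂ) / (t : ℂ) *
        (planeFourier f ξ * (starRingEnd ℂ) (planeFourier g ξ))) ∂ν := by
    rw [integral_integral_swap (f := fun (t : ℝ) (ξ : EPlane) =>
      (Real.fourierChar (-(t * ξ.fst + Q t * ξ.snd)) : ℂ) / (t : ℂ) *
        (planeFourier f ξ * (starRingEnd ℂ) (planeFourier g ξ))) hi2]
    refine integral_congr_ae (Eventually.of_forall fun z => ?_)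
    exact (integral_mul_const _ _).symm
  rw [hL, hR]
  refine integral_congr_ae (Eventually.of_forall fun t => ?_)
  have h := integral_comp_sub_mul_conj f g (t, Q t)
  calc ∫ z, curveIntegrand Q f z t * (starRingEnd ℂ) (g z)
      = (t : ℂ)⁻¹ * ∫ z, f (z - (t, Q t)) * (starRingEnd ℂ) (g z) := by
        rw [← integral_const_mul]
        refine integral_congr_ae (Eventually.of_forall fun z => ?_)
        simp only [curveIntegrand, div_eq_inv_mul, mul_assoc]
        rfl
    _ = _ := by
        rw [h, ← integral_const_mul]
        refine integral_congr_ae (Eventually.of_forall fun z => ?_)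
        simp only [div_eq_inv_mul, mul_assoc]

/-- Testing the weak multiplier identity on the transform of `f` itself bounds its `L²` norm. -/
theorem eLpNorm_setHilbert_le {Q : ℝ → ℝ} (hQ : Continuous Q) {δ R C : ℝ} (hδ : 0 < δ)
    (hC : ∀ ξ, ‖curveMultiplier Q (annulus δ R) ξ‖ ≤ C) (f : L2Plane) :
    eLpNorm (setHilbert Q (annulus δ R) f) 2 ≤
      eLpNorm (fun ξ : EPlane => curveMultiplier Q (annulus δ R) (ξ.fst, ξ.snd) *
        planeFourier f ξ) 2 := by
  have hW : MemLp (fun ξ : EPlane => curveMultiplier Q (annulus δ R) (ξ.fst, ξ.snd) *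
        planeFourier f ξ) 2 := by
    refine ((Lp.memLp (planeFourier f)).const_mul (C : ℂ)).of_le
      ((stronglyMeasurable_curveMultiplier hQ _).aestronglyMeasurable.mul (Lp.memLp _).1)
      (Eventually.of_forall fun ξ => ?_)
    rw [norm_mul, norm_mul, Complex.norm_real]
    exact mul_le_mul_of_nonneg_right ((hC _).trans (le_abs_self C)) (norm_nonneg _)
  have hH := memLp_setHilbert_annulus hQ (R := R) hδ f
  set G : L2Plane := hH.toLp _ with hG
  set W := hW.toLp _ with hWdef
  have h1 : inner ℂ G G = inner ℂ (planeFourier G) W := by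
    have := integral_setHilbert_mul_conj hQ (R := R) hδ f G
    rw [L2.inner_def, L2.inner_def]
    refine Eq.trans (integral_congr_ae ?_) (this.trans (integral_congr_ae ?_))
    · filter_upwards [hH.coeFn_toLp] with z hz
      rw [RCLike.inner_apply, ← hz]
    · filter_upwards [hW.coeFn_toLp] with z hz
      rw [RCLike.inner_apply, hz, mul_assoc]
  have h2 : ‖G‖ ≤ ‖W‖ := by
    have h3 : ‖inner ℂ G G‖ ≤ ‖G‖ * ‖W‖ := by
      rw [h1, ← planeFourier.norm_map G]
      exact norm_inner_le_norm _ _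
    rw [inner_self_eq_norm_sq_to_K] at h3
    simp only [norm_pow, Complex.coe_algebraMap, Complex.norm_real, norm_norm] at h3
    rcases (norm_nonneg G).eq_or_lt with h0 | h0
    · rw [← h0]; exact norm_nonneg _
    · nlinarith
  rw [hG, hWdef, Lp.norm_toLp, Lp.norm_toLp] at h2
  exact (ENNReal.toReal_le_toReal hH.2.ne hW.2.ne).1 h2

theorem eLpNorm_setHilbert_le_mul {Q : ℝ → ℝ} (hQ : Continuous Q) {δ R C : ℝ} (hδ : 0 < δ)
    (hC : ∀ ξ, ‖curveMultiplier Q (annulus δ R) ξ‖ ≤ C) (f : L2Plane) :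
    eLpNorm (setHilbert Q (annulus δ R) f) 2 ≤ ENNReal.ofReal C * eLpNorm f 2 := by
  refine (eLpNorm_setHilbert_le hQ hδ hC f).trans ?_
  have h1 := eLpNorm_le_mul_eLpNorm_of_ae_le_mul (μ := (volume : Measure EPlane)) (c := C) (p := 2)
    (f := fun ξ : EPlane => curveMultiplier Q (annulus δ R) (ξ.fst, ξ.snd) * planeFourier f ξ)
    (g := planeFourier f) (Eventually.of_forall fun ξ => by
      rw [norm_mul]; exact mul_le_mul_of_nonneg_right (hC _) (norm_nonneg _))
  have h2 : eLpNorm (planeFourier f) 2 = eLpNorm f 2 := by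
    rw [← Lp.enorm_def, ← Lp.enorm_def, ← ofReal_norm, ← ofReal_norm, planeFourier.norm_map]
  rwa [h2] at h1

/-! ### Truncated transforms on `L²` and their limit -/

theorem measurableSet_lt_abs (ε : ℝ) : MeasurableSet {t : ℝ | ε < |t|} :=
  measurableSet_lt measurable_const measurable_id.abs

theorem memLp_inv_restrict {ε : ℝ} (hε : 0 < ε) :
    MemLp (fun t : ℝ => (t : ℂ)⁻¹) 2 (volume.restrict {t : ℝ | ε < |t|}) := by
  have hm : Measurable fun t : ℝ => (t : ℂ)⁻¹ := Complex.measurable_ofReal.inv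
  rw [memLp_two_iff_integrable_sq_norm hm.aestronglyMeasurable]
  refine ((integrable_inv_one_add_sq.const_mul (1 + ε⁻¹ ^ 2)).integrableOn
    (s := {t : ℝ | ε < |t|})).mono' (hm.norm.pow_const 2).aestronglyMeasurable ?_
  filter_upwards [ae_restrict_mem (measurableSet_lt_abs ε)] with t ht
  have ht' : ε < |t| := ht
  have h0 : 0 < t ^ 2 := by rw [← sq_abs]; exact pow_pos (hε.trans ht') 2
  have h1 : ε ^ 2 ≤ t ^ 2 := by rw [← sq_abs t]; exact pow_le_pow_left₀ hε.le ht'.le 2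
  rw [Real.norm_of_nonneg (sq_nonneg _), norm_inv, Complex.norm_real, inv_pow, Real.norm_eq_abs,
    sq_abs, ← div_eq_mul_inv, le_div_iff₀ (by positivity), inv_mul_le_iff₀ h0]
  have h2 : 1 ≤ t ^ 2 * ε⁻¹ ^ 2 := by
    rw [inv_pow, ← div_eq_mul_inv, one_le_div (by positivity)]
    exact h1
  nlinarith

/-- For every `x` and almost every `y` the function `f` is square integrable with respect to `dt`
along the translated curve: integrating the square in `y` first gives `‖f‖²`, whatever `x` is. -/
theorem ae_lintegral_curve_lt_top {Q : ℝ → ℝ} (hQ : Continuous Q) {f : ℝ × ℝ → ℂ}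
    (hf : Measurable f) (hf2 : MemLp f 2) :
    ∀ᵐ z : ℝ × ℝ, ∫⁻ t, ‖f (z.1 - t, z.2 - Q t)‖ₑ ^ (2 : ENNReal).toReal < ⊤ := by
  have hsub : Continuous fun p : (ℝ × ℝ) × ℝ => (p.1.1 - p.2, p.1.2 - Q p.2) := by fun_prop
  have hm : Measurable fun p : (ℝ × ℝ) × ℝ =>
      ‖f (p.1.1 - p.2, p.1.2 - Q p.2)‖ₑ ^ (2 : ENNReal).toReal :=
    (hf.comp hsub.measurable).enorm.pow_const _
  have hG := Measurable.lintegral_prod_right' (ν := (volume : Measure ℝ)) hm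
  have hS : MeasurableSet {z : ℝ × ℝ |
      ∫⁻ t, ‖f (z.1 - t, z.2 - Q t)‖ₑ ^ (2 : ENNReal).toReal < ⊤} :=
    measurableSet_lt hG measurable_const
  rw [Measure.volume_eq_prod, Measure.ae_prod_iff_ae_ae hS]
  refine Eventually.of_forall fun x => ?_
  have hGx : Measurable fun y : ℝ =>
      ∫⁻ t, ‖f (x - t, y - Q t)‖ₑ ^ (2 : ENNReal).toReal := hG.comp measurable_prodMk_left
  refine ae_lt_top hGx (ne_of_lt ?_)
  have h2 : Measurable fun w : ℝ × ℝ => ‖f w‖ₑ ^ (2 : ENNReal).toReal := hf.enorm.pow_const _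
  calc ∫⁻ y, ∫⁻ t, ‖f (x - t, y - Q t)‖ₑ ^ (2 : ENNReal).toReal
      = ∫⁻ t, ∫⁻ y, ‖f (x - t, y - Q t)‖ₑ ^ (2 : ENNReal).toReal := by
        refine lintegral_lintegral_swap (Measurable.aemeasurable ?_)
        exact hm.comp (g := fun p : (ℝ × ℝ) × ℝ =>
          ‖f (p.1.1 - p.2, p.1.2 - Q p.2)‖ₑ ^ (2 : ENNReal).toReal)
          (f := fun p : ℝ × ℝ => ((x, p.1), p.2)) (by fun_prop)
    _ = ∫⁻ t, ∫⁻ y, ‖f (x - t, y)‖ₑ ^ (2 : ENNReal).toReal := by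
        refine lintegral_congr fun t => ?_
        exact lintegral_sub_right_eq_self (fun y => ‖f (x - t, y)‖ₑ ^ (2 : ENNReal).toReal) (Q t)
    _ = ∫⁻ t, ∫⁻ y, ‖f (t, y)‖ₑ ^ (2 : ENNReal).toReal :=
        lintegral_sub_left_eq_self (fun t => ∫⁻ y, ‖f (t, y)‖ₑ ^ (2 : ENNReal).toReal) x
    _ = ∫⁻ w, ‖f w‖ₑ ^ (2 : ENNReal).toReal := by
        rw [Measure.volume_eq_prod, lintegral_prod _ h2.aemeasurable]
    _ < ⊤ := (eLpNorm_lt_top_iff_lintegral_rpow_enorm_lt_top two_ne_zero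
        ENNReal.ofNat_ne_top).1 hf2.2

/-- Absolute convergence almost everywhere: by Cauchy-Schwarz, since `1 / t` is square integrable
on `|t| > ε`. The exceptional set does not depend on `ε`. -/
theorem ae_integrableOn_curveIntegrand {Q : ℝ → ℝ} (hQ : Continuous Q) (f : L2Plane) :
    ∀ᵐ z : ℝ × ℝ, ∀ ε : ℝ, 0 < ε → IntegrableOn (curveIntegrand Q f z) {t : ℝ | ε < |t|} := by
  filter_upwards [ae_lintegral_curve_lt_top hQ (measurable_coe_L2Plane f)
    (Lp.memLp f)] with z hz ε hε
  have hsub : Continuous fun t : ℝ => (z.1 - t, z.2 - Q t) := by fun_prop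
  have h1 : MemLp (fun t => f (z.1 - t, z.2 - Q t)) 2 :=
    ⟨((measurable_coe_L2Plane f).comp hsub.measurable).aestronglyMeasurable,
      (eLpNorm_lt_top_iff_lintegral_rpow_enorm_lt_top two_ne_zero ENNReal.ofNat_ne_top).2 hz⟩
  have := (h1.restrict {t : ℝ | ε < |t|}).integrable_mul (memLp_inv_restrict hε)
  exact this.congr (Eventually.of_forall fun t => (div_eq_mul_inv _ _).symm)

/-- The curve `(t, Q t)` is continuous, its multipliers on annuli are bounded by `C`, and at each
fixed frequency they are `O(R)` on annuli of small outer radius `R`. -/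
structure MultiplierBound (Q : ℝ → ℝ) (C : ℝ) : Prop where
  continuous : Continuous Q
  norm_le : ∀ (ξ : ℝ × ℝ) (δ R : ℝ), 0 < δ → δ ≤ R → ‖curveMultiplier Q (annulus δ R) ξ‖ ≤ C
  norm_le_mul : ∀ ξ : ℝ × ℝ, ∃ M : ℝ, ∀ δ R : ℝ, 0 < δ → δ ≤ R → R ≤ 1 →
    ‖curveMultiplier Q (annulus δ R) ξ‖ ≤ M * R

theorem stronglyMeasurable_truncatedHilbert {Q : ℝ → ℝ} (hQ : Continuous Q) (f : L2Plane) (ε : ℝ) :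
    StronglyMeasurable (truncatedHilbert Q ε f) :=
  stronglyMeasurable_setHilbert hQ (measurable_coe_L2Plane f) _

/-- The truncated transforms are limits of transforms over annuli, so Fatou's lemma gives the
bound. -/
theorem eLpNorm_truncatedHilbert_le {Q : ℝ → ℝ} {C : ℝ} (h : MultiplierBound Q C) (f : L2Plane)
    {ε : ℝ} (hε : 0 < ε) :
    eLpNorm (truncatedHilbert Q ε f) 2 ≤ ENNReal.ofReal C * eLpNorm f 2 := by
  have hmono : Monotone fun n : ℕ => annulus ε (ε + n) := by
    intro m n hmn t ht
    exact ⟨ht.1, ht.2.trans (by gcongr)⟩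
  have hunion : ⋃ n : ℕ, annulus ε (ε + n) = {t : ℝ | ε < |t|} := by
    ext t
    simp only [Set.mem_iUnion]
    constructor
    · rintro ⟨n, hn⟩
      exact hn.1
    · intro ht
      obtain ⟨n, hn⟩ := exists_nat_ge |t|
      exact ⟨n, ht, by linarith⟩
  have hlim : ∀ᵐ z, Tendsto (fun n : ℕ => setHilbert Q (annulus ε (ε + n)) f z) atTop
      (𝓝 (truncatedHilbert Q ε f z)) := by
    filter_upwards [ae_integrableOn_curveIntegrand h.continuous f] with z hz
    have := tendsto_setIntegral_of_monotone (fun n : ℕ => measurableSet_annulus ε (ε + n)) hmono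
      (f := curveIntegrand Q f z) (μ := volume) (by rw [hunion]; exact hz ε hε)
    rw [hunion] at this
    exact this
  refine (Lp.eLpNorm_lim_le_liminf_eLpNorm (fun n => (stronglyMeasurable_setHilbert h.continuous
    (measurable_coe_L2Plane f) _).aestronglyMeasurable) _ hlim).trans ?_
  refine liminf_le_of_frequently_le' (Frequently.of_forall fun n => ?_)
  exact eLpNorm_setHilbert_le_mul h.continuous hε
    (fun ξ => h.norm_le ξ _ _ hε (by simp)) f

theorem memLp_truncatedHilbert {Q : ℝ → ℝ} {C : ℝ} (h : MultiplierBound Q C) (f : L2Plane)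
    {ε : ℝ} (hε : 0 < ε) : MemLp (truncatedHilbert Q ε f) 2 :=
  ⟨(stronglyMeasurable_truncatedHilbert h.continuous f ε).aestronglyMeasurable,
    (eLpNorm_truncatedHilbert_le h f hε).trans_lt
      (ENNReal.mul_lt_top ENNReal.ofReal_lt_top (Lp.memLp f).2)⟩

theorem setIntegral_lt_abs_sub {k : ℝ → ℂ} {δ ε : ℝ} (hδε : δ ≤ ε)
    (hk : IntegrableOn k {t : ℝ | δ < |t|}) :
    ∫ t in {t : ℝ | δ < |t|}, k t =
      (∫ t in annulus δ ε, k t) + ∫ t in {t : ℝ | ε < |t|}, k t := by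
  have hU : {t : ℝ | δ < |t|} = annulus δ ε ∪ {t : ℝ | ε < |t|} := by
    ext t
    constructor
    · intro ht
      rcases le_or_gt |t| ε with h | h
      · exact Or.inl ⟨ht, h⟩
      · exact Or.inr h
    · rintro (ht | ht)
      · exact ht.1
      · exact hδε.trans_lt ht
  have hd : Disjoint (annulus δ ε) {t : ℝ | ε < |t|} := by
    rw [Set.disjoint_left]
    intro t ht ht'
    exact absurd ht.2 (not_le.2 ht')
  rw [hU] at hk ⊢
  exact setIntegral_union hd (measurableSet_lt_abs ε) (hk.mono_set Set.subset_union_left)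
    (hk.mono_set Set.subset_union_right)

/-- The difference of two truncated transforms is the transform over an annulus. -/
theorem eLpNorm_truncatedHilbert_sub_le {Q : ℝ → ℝ} {C : ℝ} (h : MultiplierBound Q C) (f : L2Plane)
    {δ ε : ℝ} (hδ : 0 < δ) (hε : 0 < ε) :
    eLpNorm (truncatedHilbert Q δ f - truncatedHilbert Q ε f) 2 ≤
      eLpNorm (fun ξ : EPlane => curveMultiplier Q (annulus (min δ ε) (max δ ε)) (ξ.fst, ξ.snd) *
        planeFourier f ξ) 2 := by
  wlog hle : δ ≤ ε generalizing δ ε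
  · rw [eLpNorm_sub_comm, min_comm, max_comm]
    exact this hε hδ (le_of_not_ge hle)
  rw [min_eq_left hle, max_eq_right hle]
  refine le_trans (le_of_eq (eLpNorm_congr_ae ?_)) (eLpNorm_setHilbert_le h.continuous hδ
    (fun ξ => h.norm_le ξ _ _ hδ hle) f)
  filter_upwards [ae_integrableOn_curveIntegrand h.continuous f] with z hz
  rw [Pi.sub_apply, truncatedHilbert, setIntegral_lt_abs_sub hle (hz δ hδ)]
  simp [truncatedHilbert, setHilbert]

/-- The multipliers of the annuli between two truncation radii tend to `0` in the strong sense as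
both radii tend to `0`, by dominated convergence. -/
theorem tendsto_eLpNorm_multiplier {Q : ℝ → ℝ} {C : ℝ} (h : MultiplierBound Q C)
    (F : Lp ℂ 2 (volume : Measure EPlane)) :
    Tendsto (fun p : ℝ × ℝ => eLpNorm (fun ξ : EPlane =>
      curveMultiplier Q (annulus (min p.1 p.2) (max p.1 p.2)) (ξ.fst, ξ.snd) * F ξ) 2)
      (𝓝[>] 0 ×ˢ 𝓝[>] 0) (𝓝 0) := by
  have hpos : ∀ᶠ p : ℝ × ℝ in 𝓝[>] 0 ×ˢ 𝓝[>] 0, 0 < p.1 ∧ 0 < p.2 :=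
    (eventually_mem_nhdsWithin (a := (0:ℝ)) (s := Set.Ioi 0)).prod_mk
      (eventually_mem_nhdsWithin (a := (0:ℝ)) (s := Set.Ioi 0))
  have hmax : Tendsto (fun p : ℝ × ℝ => max p.1 p.2) (𝓝[>] 0 ×ˢ 𝓝[>] 0) (𝓝 (0:ℝ)) := by
    have h1 : Tendsto (fun p : ℝ × ℝ => p.1) (𝓝[>] 0 ×ˢ 𝓝[>] 0) (𝓝 (0:ℝ)) :=
      tendsto_fst.mono_right nhdsWithin_le_nhds
    have h2 : Tendsto (fun p : ℝ × ℝ => p.2) (𝓝[>] 0 ×ˢ 𝓝[>] 0) (𝓝 (0:ℝ)) :=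
      tendsto_snd.mono_right nhdsWithin_le_nhds
    simpa using h1.max h2
  have hlin : Tendsto (fun p : ℝ × ℝ => ∫⁻ ξ : EPlane,
      ‖curveMultiplier Q (annulus (min p.1 p.2) (max p.1 p.2)) (ξ.fst, ξ.snd) * F ξ‖ₑ ^
        (2 : ENNReal).toReal) (𝓝[>] 0 ×ˢ 𝓝[>] 0) (𝓝 (∫⁻ _ : EPlane, 0)) := by
    refine tendsto_lintegral_filter_of_dominated_convergence'
      (fun ξ => ‖(C : ℂ) * F ξ‖ₑ ^ (2 : ENNReal).toReal) ?_ ?_ ?_ ?_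
    · refine Eventually.of_forall fun p => ?_
      exact (((stronglyMeasurable_curveMultiplier h.continuous _).measurable.mul
        (Lp.stronglyMeasurable F).measurable).enorm.pow_const _).aemeasurable
    · filter_upwards [hpos] with p hp
      refine Eventually.of_forall fun ξ => ENNReal.rpow_le_rpow ?_ ENNReal.toReal_nonneg
      rw [enorm_le_iff_norm_le, norm_mul, norm_mul, Complex.norm_real]
      exact mul_le_mul_of_nonneg_right ((h.norm_le _ _ _ (lt_min hp.1 hp.2)
        min_le_max).trans (le_abs_self C)) (norm_nonneg _)
    · exact ((eLpNorm_lt_top_iff_lintegral_rpow_enorm_lt_top two_ne_zero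
        ENNReal.ofNat_ne_top).1 ((Lp.memLp F).const_mul (C : ℂ)).2).ne
    · refine Eventually.of_forall fun ξ => ?_
      obtain ⟨M, hM⟩ := h.norm_le_mul (ξ.fst, ξ.snd)
      have h0 : Tendsto (fun p : ℝ × ℝ =>
          curveMultiplier Q (annulus (min p.1 p.2) (max p.1 p.2)) (ξ.fst, ξ.snd) * F ξ)
          (𝓝[>] 0 ×ˢ 𝓝[>] 0) (𝓝 0) := by
        have h1 : Tendsto (fun p : ℝ × ℝ => M * max p.1 p.2 * ‖F ξ‖)
            (𝓝[>] 0 ×ˢ 𝓝[>] 0) (𝓝 0) := by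
          simpa using (hmax.const_mul M).mul_const ‖F ξ‖
        refine squeeze_zero_norm' ?_ h1
        filter_upwards [hpos, hmax.eventually (gt_mem_nhds zero_lt_one)] with p hp hp1
        rw [norm_mul]
        exact mul_le_mul_of_nonneg_right (hM _ _ (lt_min hp.1 hp.2) min_le_max hp1.le)
          (norm_nonneg _)
      have h2 := (ENNReal.continuous_rpow_const (y := (2 : ENNReal).toReal)).tendsto _ |>.comp
        ((continuous_enorm.tendsto _).comp h0)
      simpa [Function.comp_def] using h2
  have h3 := (ENNReal.continuous_rpow_const (y := 1 / (2 : ENNReal).toReal)).tendsto _ |>.comp hlin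
  simp only [lintegral_zero] at h3
  rw [ENNReal.zero_rpow_of_pos (by simp)] at h3
  refine h3.congr fun p => ?_
  rw [eLpNorm_eq_lintegral_rpow_enorm_toReal two_ne_zero ENNReal.ofNat_ne_top]
  rfl

theorem exists_hasHilbertL2 {Q : ℝ → ℝ} {C : ℝ} (h : MultiplierBound Q C) (f : L2Plane) :
    ∃ g : L2Plane, HasHilbertL2 Q f g ∧ ‖g‖ ≤ C * ‖f‖ := by
  classical
  set u : ℝ → L2Plane := fun ε =>
    if hε : 0 < ε then (memLp_truncatedHilbert h f hε).toLp _ else 0 with hu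
  have hupos : ∀ ε (hε : 0 < ε), u ε = (memLp_truncatedHilbert h f hε).toLp _ := fun ε hε => by
    rw [hu]; simp only [dif_pos hε]
  have hpos : ∀ᶠ ε : ℝ in 𝓝[>] 0, 0 < ε := eventually_mem_nhdsWithin
  have hC : 0 ≤ C := (norm_nonneg _).trans (h.norm_le 0 1 1 one_pos le_rfl)
  -- The family is Cauchy along the full filter `𝓝[>] 0`, not only along sequences.
  have hcauchy : Cauchy (map u (𝓝[>] 0)) := by
    rw [cauchy_map_iff', tendsto_uniformity_iff_dist_tendsto_zero]
    have hed : Tendsto (fun p : ℝ × ℝ => edist (u p.1) (u p.2)) (𝓝[>] 0 ×ˢ 𝓝[>] 0) (𝓝 0) := by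
      refine tendsto_of_tendsto_of_tendsto_of_le_of_le' tendsto_const_nhds
        (tendsto_eLpNorm_multiplier h (planeFourier f)) (Eventually.of_forall fun _ => zero_le) ?_
      filter_upwards [hpos.prod_mk hpos] with p hp
      rw [hupos _ hp.1, hupos _ hp.2, Lp.edist_toLp_toLp]
      exact eLpNorm_truncatedHilbert_sub_le h f hp.1 hp.2
    have := (ENNReal.tendsto_toReal ENNReal.zero_ne_top).comp hed
    simpa [Function.comp_def, edist_dist, ENNReal.toReal_ofReal dist_nonneg] using this
  obtain ⟨g, hg⟩ := CompleteSpace.complete hcauchy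
  have hg : Tendsto u (𝓝[>] 0) (𝓝 g) := hg
  refine ⟨g, ⟨fun ε hε => ⟨?_, memLp_truncatedHilbert h f hε⟩, ?_⟩, ?_⟩
  · filter_upwards [ae_integrableOn_curveIntegrand h.continuous f] with z hz using hz ε hε
  · rw [tendsto_iff_edist_tendsto_0] at hg
    refine hg.congr' ?_
    filter_upwards [hpos] with ε hε
    rw [hupos ε hε, Lp.edist_def]
    refine eLpNorm_congr_ae ?_
    filter_upwards [(memLp_truncatedHilbert h f hε).coeFn_toLp] with z hz
    rw [Pi.sub_apply, Pi.sub_apply, hz]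
  · refine le_of_tendsto hg.norm ?_
    filter_upwards [hpos] with ε hε
    rw [hupos ε hε, Lp.norm_toLp, Lp.norm_def, ← ENNReal.toReal_ofReal hC, ← ENNReal.toReal_mul]
    exact ENNReal.toReal_mono (ENNReal.mul_lt_top ENNReal.ofReal_lt_top (Lp.memLp f).2).ne
      (eLpNorm_truncatedHilbert_le h f hε)

/-! ### Linearity, Schwartz functions and the Hilbert transform -/

theorem ae_curveIntegrand_congr {Q : ℝ → ℝ} (hQ : Continuous Q) {f f' : ℝ × ℝ → ℂ}
    (hff' : f =ᵐ[volume] f') : ∀ᵐ z, curveIntegrand Q f z =ᵐ[volume] curveIntegrand Q f' z := by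
  filter_upwards [ae_ae_shear hQ hff'] with z hz
  filter_upwards [hz] with t ht
  rw [curveIntegrand, curveIntegrand, ht]

theorem truncatedHilbert_congr_ae {Q : ℝ → ℝ} (hQ : Continuous Q) {f f' : ℝ × ℝ → ℂ}
    (hff' : f =ᵐ[volume] f') (ε : ℝ) :
    truncatedHilbert Q ε f =ᵐ[volume] truncatedHilbert Q ε f' := by
  filter_upwards [ae_curveIntegrand_congr hQ hff'] with z hz
  exact integral_congr_ae (ae_restrict_of_ae hz)

theorem truncatedHilbert_smul_add_ae {Q : ℝ → ℝ} (hQ : Continuous Q) (c : ℂ) (f f' : L2Plane)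
    {ε : ℝ} (hε : 0 < ε) :
    truncatedHilbert Q ε (c • f + f' : L2Plane) =ᵐ[volume]
      c • truncatedHilbert Q ε f + truncatedHilbert Q ε f' := by
  have h1 : (c • f + f' : L2Plane) =ᵐ[volume] c • (f : ℝ × ℝ → ℂ) + f' :=
    (Lp.coeFn_add _ _).trans ((Lp.coeFn_smul c f).add EventuallyEq.rfl)
  refine (truncatedHilbert_congr_ae hQ h1 ε).trans ?_
  filter_upwards [ae_integrableOn_curveIntegrand hQ f, ae_integrableOn_curveIntegrand hQ f']
    with z hz hz'
  simp only [Pi.add_apply, Pi.smul_apply, truncatedHilbert]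
  have hi : IntegrableOn (fun t => c • curveIntegrand Q f z t) {t : ℝ | ε < |t|} :=
    (hz ε hε).smul c
  rw [← integral_smul, ← integral_add hi (hz' ε hε)]
  refine integral_congr_ae (Eventually.of_forall fun t => ?_)
  simp only [curveIntegrand, Pi.add_apply, Pi.smul_apply, smul_eq_mul]
  ring

theorem tendsto_smul_add {Q : ℝ → ℝ} (hQ : Continuous Q) (c : ℂ) {f f' g g' : L2Plane}
    (h : HasHilbertL2 Q f g) (h' : HasHilbertL2 Q f' g') :
    Tendsto (fun ε : ℝ => eLpNorm (truncatedHilbert Q ε ⇑(c • f + f') -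
      ⇑(c • g + g')) 2) (𝓝[>] 0) (𝓝 0) := by
  have hlim : Tendsto (fun ε : ℝ => ‖c‖ₑ * eLpNorm (truncatedHilbert Q ε f - ⇑g) 2 +
      eLpNorm (truncatedHilbert Q ε f' - ⇑g') 2) (𝓝[>] 0) (𝓝 0) := by
    have := (ENNReal.Tendsto.const_mul (a := ‖c‖ₑ) h.2 (Or.inr enorm_ne_top)).add h'.2
    simpa using this
  refine tendsto_of_tendsto_of_tendsto_of_le_of_le' tendsto_const_nhds hlim
    (Eventually.of_forall fun _ => zero_le) ?_
  filter_upwards [eventually_mem_nhdsWithin (a := (0:ℝ)) (s := Set.Ioi 0)] with ε hε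
  have hae : truncatedHilbert Q ε (c • f + f' : L2Plane) - ((c • g + g' : L2Plane) : ℝ × ℝ → ℂ)
      =ᵐ[volume] c • (truncatedHilbert Q ε f - ⇑g) + (truncatedHilbert Q ε f' - ⇑g') := by
    filter_upwards [truncatedHilbert_smul_add_ae hQ c f f' hε, Lp.coeFn_add (c • g) g',
      Lp.coeFn_smul c g] with z h1 h2 h3
    simp only [Pi.sub_apply, Pi.add_apply, Pi.smul_apply] at h1 h2 h3 ⊢
    rw [h1, h2, h3, smul_sub]
    ring
  have hm : ∀ f g : L2Plane, AEStronglyMeasurable (truncatedHilbert Q ε f - ⇑g) volume :=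
    fun f g => (stronglyMeasurable_truncatedHilbert hQ f ε).aestronglyMeasurable.sub
      (Lp.stronglyMeasurable g).aestronglyMeasurable
  rw [eLpNorm_congr_ae hae]
  refine (eLpNorm_add_le ((hm f g).const_smul c) (hm f' g') one_le_two).trans ?_
  rw [eLpNorm_const_smul]

theorem eq_of_tendsto_eLpNorm {ι : Type*} {l : Filter ι} [l.NeBot] {u : ι → ℝ × ℝ → ℂ}
    (hu : ∀ i, AEStronglyMeasurable (u i) volume) {g g' : L2Plane}
    (h : Tendsto (fun i => eLpNorm (u i - ⇑g) 2) l (𝓝 0))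
    (h' : Tendsto (fun i => eLpNorm (u i - ⇑g') 2) l (𝓝 0)) : g = g' := by
  have hsum : Tendsto (fun i => eLpNorm (u i - ⇑g') 2 + eLpNorm (u i - ⇑g) 2) l (𝓝 0) := by
    simpa using h'.add h
  have hle : eLpNorm (⇑g - ⇑g') 2 ≤ 0 := by
    refine ge_of_tendsto hsum (Eventually.of_forall fun i => ?_)
    have : ⇑g - ⇑g' = (u i - ⇑g') - (u i - ⇑g) := by abel
    rw [this]
    exact eLpNorm_sub_le ((hu i).sub (Lp.aestronglyMeasurable g'))
      ((hu i).sub (Lp.aestronglyMeasurable g)) one_le_two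
  rw [← Lp.edist_def] at hle
  exact edist_eq_zero.1 (le_antisymm hle zero_le)

theorem schwartz_integrableOn_curveIntegrand {Q : ℝ → ℝ} (hQ : Continuous Q) (f : 𝓢(ℝ × ℝ, ℂ))
    (z : ℝ × ℝ) {ε : ℝ} (hε : 0 < ε) : IntegrableOn (curveIntegrand Q f z) {t : ℝ | ε < |t|} := by
  obtain ⟨C0, -, h0⟩ := f.decay 0 0
  obtain ⟨C2, -, h2⟩ := f.decay 2 0
  have hcont : Continuous fun t : ℝ => f (z.1 - t, z.2 - Q t) := by
    have := f.continuous
    fun_prop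
  have hint : Integrable fun t : ℝ => f (z.1 - t, z.2 - Q t) := by
    refine ((integrable_inv_one_add_sq.comp_sub_left z.1).const_mul (C0 + C2)).mono'
      hcont.aestronglyMeasurable (Eventually.of_forall fun t => ?_)
    have e0 := h0 (z.1 - t, z.2 - Q t)
    have e2 := h2 (z.1 - t, z.2 - Q t)
    rw [norm_iteratedFDeriv_zero] at e0 e2
    rw [← div_eq_mul_inv, le_div_iff₀ (by positivity)]
    have hn : (z.1 - t) ^ 2 ≤ ‖(z.1 - t, z.2 - Q t)‖ ^ 2 := by
      rw [← sq_abs]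
      exact pow_le_pow_left₀ (abs_nonneg _) (norm_fst_le (z.1 - t, z.2 - Q t)) 2
    have := mul_le_mul_of_nonneg_right hn (norm_nonneg (f (z.1 - t, z.2 - Q t)))
    linarith
  have hm : Measurable fun t : ℝ => (t : ℂ)⁻¹ := Complex.measurable_ofReal.inv
  refine (hint.integrableOn.bdd_mul (c := ε⁻¹) hm.aestronglyMeasurable ?_).congr
    (Eventually.of_forall fun t => (div_eq_inv_mul _ _).symm)
  filter_upwards [ae_restrict_mem (measurableSet_lt_abs ε)] with t ht
  rw [norm_inv, Complex.norm_real, Real.norm_eq_abs]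
  exact inv_anti₀ hε (le_of_lt ht)

theorem SchwartzMap.exists_norm_sub_le (f : 𝓢(ℝ × ℝ, ℂ)) :
    ∃ L : ℝ, 0 ≤ L ∧ ∀ w w', ‖f w - f w'‖ ≤ L * ‖w - w'‖ := by
  obtain ⟨L, hL0, hL⟩ := f.decay 0 1
  refine ⟨L, hL0.le, fun w w' => ?_⟩
  refine Convex.norm_image_sub_le_of_norm_fderiv_le (𝕜 := ℝ) (s := Set.univ)
    (fun x _ => f.differentiableAt) (fun x _ => ?_) convex_univ (Set.mem_univ _) (Set.mem_univ _)
  have := hL x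
  rwa [pow_zero, one_mul, norm_iteratedFDeriv_one] at this

/-- The pointwise principal value of a Schwartz function exists: pairing `t` with `-t` leaves a
bounded integrand near `0`. -/
theorem exists_hasHilbertAt {Q : ℝ → ℝ} (hQ : Continuous Q) {K : ℝ}
    (hK : ∀ t ∈ Set.Ioc (0:ℝ) 1, |Q t - Q (-t)| ≤ K * t) (f : 𝓢(ℝ × ℝ, ℂ)) (z : ℝ × ℝ) :
    ∃ l, HasHilbertAt Q f z l := by
  have hint : ∀ ε : ℝ, 0 < ε → IntegrableOn (curveIntegrand Q f z) {t : ℝ | ε < |t|} :=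
    fun ε hε => schwartz_integrableOn_curveIntegrand hQ f z hε
  have hkc : ContinuousOn (curveIntegrand Q f z) {0}ᶜ := by
    refine ContinuousOn.div (Continuous.continuousOn ?_) Complex.continuous_ofReal.continuousOn ?_
    · have := f.continuous
      fun_prop
    · intro x hx
      exact_mod_cast hx
  obtain ⟨L, hL0, hL⟩ := f.exists_norm_sub_le
  set D : ℝ → ℂ := fun t => curveIntegrand Q f z t + curveIntegrand Q f z (-t) with hD
  have hDb : ∀ t ∈ Set.Ioc (0:ℝ) 1, ‖D t‖ ≤ L * (2 + K) := by
    intro t ht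
    have e1 : D t = (f (z.1 - t, z.2 - Q t) - f (z.1 - -t, z.2 - Q (-t))) / (t : ℂ) := by
      simp only [hD, curveIntegrand]
      push_cast
      rw [div_neg, sub_div]
      ring
    rw [e1, norm_div, Complex.norm_real, Real.norm_eq_abs, abs_of_pos ht.1, div_le_iff₀ ht.1]
    refine (hL _ _).trans ?_
    rw [mul_assoc]
    refine mul_le_mul_of_nonneg_left ?_ hL0
    have hKt := hK t ht
    have hK0 : 0 ≤ K * t := (abs_nonneg _).trans hKt
    rw [Prod.mk_sub_mk, Prod.norm_mk, max_le_iff, Real.norm_eq_abs, Real.norm_eq_abs]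
    constructor
    · rw [show z.1 - t - (z.1 - -t) = -(2 * t) by ring, abs_neg, abs_of_pos (by linarith [ht.1])]
      linarith
    · rw [show z.2 - Q t - (z.2 - Q (-t)) = -(Q t - Q (-t)) by ring, abs_neg]
      linarith [ht.1]
  have hDc : ContinuousOn D {0}ᶜ :=
    hkc.add (hkc.comp continuous_neg.continuousOn fun x hx => by
      simpa using hx)
  have hDi : IntegrableOn D (Set.uIcc 0 1) := by
    rw [Set.uIcc_of_le zero_le_one, integrableOn_Icc_iff_integrableOn_Ioc]
    refine IntegrableOn.of_bound (by simp)
      ((hDc.mono fun t ht => ht.1.ne').aestronglyMeasurable measurableSet_Ioc) (L * (2 + K)) ?_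
    filter_upwards [ae_restrict_mem measurableSet_Ioc] with t ht using hDb t ht
  refine ⟨(∫ t in (0:ℝ)..1, D t) + truncatedHilbert Q 1 f z, hint, ?_⟩
  have hprim : Tendsto (fun ε : ℝ => ∫ t in ε..1, D t) (𝓝[>] 0) (𝓝 (∫ t in (0:ℝ)..1, D t)) := by
    have h1 := intervalIntegral.continuousOn_primitive_interval_left hDi 0 (by simp)
    rw [Set.uIcc_of_le zero_le_one] at h1
    refine h1.tendsto.mono_left ?_
    rw [← nhdsWithin_Ioo_eq_nhdsGT (zero_lt_one (α := ℝ))]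
    exact nhdsWithin_mono _ Set.Ioo_subset_Icc_self
  refine (hprim.add_const (truncatedHilbert Q 1 f z)).congr' ?_
  filter_upwards [Ioo_mem_nhdsGT (zero_lt_one (α := ℝ))] with ε hε
  rw [truncatedHilbert, truncatedHilbert, setIntegral_lt_abs_sub hε.2.le (hint ε hε.1),
    setIntegral_annulus hε.1 hε.2.le hkc]

/-- The `L²` and the pointwise principal values agree almost everywhere, by Fatou's lemma along a
sequence of truncation radii. -/
theorem ae_eq_of_hasHilbertL2_of_hasHilbertAt {Q : ℝ → ℝ} (hQ : Continuous Q)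
    {f : ℝ × ℝ → ℂ} {F G : L2Plane} (hff : F =ᵐ[volume] f) (hG : HasHilbertL2 Q F G)
    {g : ℝ × ℝ → ℂ} (hg : ∀ z, HasHilbertAt Q f z (g z)) : G =ᵐ[volume] g := by
  have hseq : Tendsto (fun n : ℕ => 1 / ((n : ℝ) + 1)) atTop (𝓝[>] 0) :=
    tendsto_nhdsWithin_iff.2 ⟨tendsto_one_div_add_atTop_nhds_zero_nat,
      Eventually.of_forall fun n => by
        rw [Set.mem_Ioi]; positivity⟩
  have hlim : ∀ᵐ z, Tendsto (fun n : ℕ =>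
      (truncatedHilbert Q (1 / ((n : ℝ) + 1)) F - ⇑G) z) atTop
        (𝓝 ((g - ⇑G) z)) := by
    filter_upwards [ae_curveIntegrand_congr hQ hff] with z hz
    have h1 := ((hg z).2.comp hseq).sub_const (G z)
    refine h1.congr fun n => ?_
    simp only [Function.comp_apply, Pi.sub_apply, truncatedHilbert]
    rw [integral_congr_ae (ae_restrict_of_ae hz)]
  have hle := Lp.eLpNorm_lim_le_liminf_eLpNorm (p := 2) (fun n : ℕ =>
    (stronglyMeasurable_truncatedHilbert hQ F
      (1 / ((n : ℝ) + 1))).aestronglyMeasurable.sub (Lp.aestronglyMeasurable G)) _ hlim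
  have h0 : eLpNorm (g - ⇑G) 2 = 0 := by
    have := (hG.2.comp hseq).liminf_eq
    simp only [Function.comp_def] at this
    rw [this] at hle
    exact le_antisymm hle zero_le
  have hm : AEStronglyMeasurable (g - (G : ℝ × ℝ → ℂ)) volume :=
    aestronglyMeasurable_of_tendsto_ae atTop (fun n : ℕ =>
      (stronglyMeasurable_truncatedHilbert hQ F
        (1 / ((n : ℝ) + 1))).aestronglyMeasurable.sub (Lp.aestronglyMeasurable G)) hlim
  rw [eLpNorm_eq_zero_iff hm two_ne_zero] at h0
  filter_upwards [h0] with z hz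
  exact (sub_eq_zero.1 hz).symm

theorem exists_isHilbertTransformAlong {Q : ℝ → ℝ} {C K : ℝ} (h : MultiplierBound Q C)
    (hK : ∀ t ∈ Set.Ioc (0:ℝ) 1, |Q t - Q (-t)| ≤ K * t) :
    ∃ T : L2Plane →L[ℂ] L2Plane, IsHilbertTransformAlong Q T ∧ ∀ f, ‖T f‖ ≤ C * ‖f‖ := by
  choose T hT hTn using exists_hasHilbertL2 h
  have hlin : ∀ (c : ℂ) (f f' : L2Plane), T (c • f + f') = c • T f + T f' := fun c f f' =>
    eq_of_tendsto_eLpNorm (fun ε =>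
        (stronglyMeasurable_truncatedHilbert h.continuous _ ε).aestronglyMeasurable)
      (hT _).2 (tendsto_smul_add h.continuous c (hT f) (hT f'))
  have hT0 : T 0 = 0 := norm_le_zero_iff.1 (by simpa using hTn 0)
  let T' : L2Plane →ₗ[ℂ] L2Plane :=
    { toFun := T
      map_add' := fun f f' => by simpa using hlin 1 f f'
      map_smul' := fun c f => by simpa [hT0] using hlin c f 0 }
  refine ⟨T'.mkContinuous C hTn, ⟨hT, fun f => ?_⟩, hTn⟩
  choose g hg using exists_hasHilbertAt h.continuous hK f
  exact ⟨g, hg, ae_eq_of_hasHilbertL2_of_hasHilbertAt h.continuous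
    (f.coeFn_toLp 2 volume) (hT _) hg⟩

theorem exists_abs_fewnomial_sub_neg_le {d : ℕ} (a : Fin d → ℝ) (α : Fin d → ℕ)
    (hα : ∀ i, 0 < α i) :
    ∃ K : ℝ, ∀ t ∈ Set.Ioc (0:ℝ) 1, |fewnomial a α t - fewnomial a α (-t)| ≤ K * t := by
  refine ⟨∑ i, |a i| * 2, fun t ht => ?_⟩
  rw [fewnomial, fewnomial, ← Finset.sum_sub_distrib, Finset.sum_mul]
  refine (Finset.abs_sum_le_sum_abs _ _).trans (Finset.sum_le_sum fun i _ => ?_)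
  rw [← mul_sub, abs_mul, mul_assoc]
  refine mul_le_mul_of_nonneg_left ?_ (abs_nonneg _)
  have h1 : t ^ α i ≤ t := pow_le_of_le_one ht.1.le ht.2 (hα i).ne'
  refine (abs_sub _ _).trans ?_
  rw [abs_pow, abs_pow, abs_neg, abs_of_pos ht.1]
  linarith

theorem corollary1p2 (d : ℕ) :
    ∃ C : ℝ, ∀ (a : Fin d → ℝ) (α : Fin d → ℕ), (∀ i, 0 < α i) →
      ∃ T : L2Plane →L[ℂ] L2Plane,
        IsHilbertTransformAlong (fewnomial a α) T ∧ ∀ f : L2Plane, ‖T f‖ ≤ C * ‖f‖ := by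
  obtain ⟨C, hC⟩ := exists_norm_curveMultiplier_le d
  refine ⟨C, fun a α hα => ?_⟩
  obtain ⟨K, hK⟩ := exists_abs_fewnomial_sub_neg_le a α hα
  exact exists_isHilbertTransformAlong ⟨continuous_fewnomial a α, hC a α hα,
    exists_norm_curveMultiplier_le_mul a α hα⟩ hK
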